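/- Let $\sigma>0$, $\nu>0$, and consider on $(0,\infty)\times(0,1)$ the viscous sheet system $$v_t+vv_x=\sigma h_{xxx}+\frac{\nu}{h}(hv_x)_x,\qquad h_t=-(hv)_x,$$ with boundary conditions $h_x=v=0$ at $x=0,1$ and initial data $h(\cdot,0)=h_0$, $v(\cdot,0)=v_0$, where $(h_0,v_0)\in H^1(0,1)\times L^2(0,1)$, $h_0\ge 0$ and $M:=\int_0^1h_0\,dx>0$. A global nonnegative weak solution is a pair $(h,v)$ with $h\ge0$, $h\in L^\infty_{loc}([0,\infty);H^1(0,1))\cap L^2_{loc}([0,\infty);H^2(0,1))$, $h$ continuous on $[0,\infty)\times[0,1]$, $h_x(\cdot,t)=0$ at $x=0,1$ for a.e. $t$, $v\in L^\infty_{loc}([0,\infty);L^2(0,1))\cap L^2_{loc}([0,\infty);H^1_0(0,1))$, attaining the initial data, and such that for all $t\ge0$ $$\int_0^1 h(t)\varphi\,dx-\int_0^1h_0\varphi\,dx=\int_0^t\!\!\int_0^1hv\,\varphi_x\,dx\,ds\qquad\text{for all }\varphi\in C^\infty([0,1]),$$ $$\int_0^1 h(t)v(t)\varphi\,dx-\int_0^1h_0v_0\varphi\,dx=\int_0^t\!\!\int_0^1\bigl[hv^2\varphi_x-\sigma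 h_{xx}(h\varphi)_x-\nu hv_x\varphi_x\bigr]dx\,ds\qquad\text{for all }\varphi\in C_c^\infty(0,1).$$ Theorem (asymptotic exponential decay). There exist positive constants $A,B,A_1,B_1$ depending only on $h_0,v_0,\sigma,\nu$ such that every global nonnegative weak solution $(h,v)$ with these data satisfies $\int_0^1h(x,t)\,dx=M$ and $$\int_0^1h_x^2(x,t)\,dx\le A\,e^{-Bt}\qquad\text{for all }t\ge0,$$ hence $$h(\cdot,t)\to M\ \text{ in } H^1(0,1)\text{ and in } C^{1/2}[0,1]\ \text{ as } t\to\infty.$$ Moreover $$\|h^{3/2}v(\cdot,t)\|_{L^2(0,1)}^2\le A_1e^{-B_1t}\quad\text{for all }t\ge0,\qquad\text{and}\qquad v(\cdot,t)\to0\ \text{ in }L^2(0,1)\ \text{ as }t\to\infty.$$ -/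

import Mathlib

open MeasureTheory Set Filter Topology
open scoped ENNReal ContDiff

namespace ViscousSheet

/-- Lebesgue measure on the unit interval `Ω = (0,1)` (the end point does not matter). -/
noncomputable abbrev unitMeasure : Measure ℝ := volume.restrict (Ioc (0 : ℝ) 1)

/-- Lebesgue measure on the space-time cylinder `Q_T = (0,T) × (0,1)`. -/
noncomputable abbrev cylMeasure (T : ℝ) : Measure (ℝ × ℝ) :=
  volume.restrict (Ioc (0 : ℝ) T ×ˢ Ioc (0 : ℝ) 1)

/-- `f` is (the continuous representative of) an element of `H¹(0,1)` and `g ∈ L²(0,1)` is its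
weak derivative: `f` is a primitive of `g` on `[0,1]`. -/
def IsH1 (f g : ℝ → ℝ) : Prop :=
  MemLp g 2 unitMeasure ∧ ∀ x ∈ Icc (0 : ℝ) 1, f x = f 0 + ∫ y in (0 : ℝ)..x, g y

/-- `f ∈ H¹₀(0,1)` with weak derivative `g`. -/
def IsH1Zero (f g : ℝ → ℝ) : Prop :=
  IsH1 f g ∧ f 0 = 0 ∧ f 1 = 0

/-- The norm of `H¹(0,1)`, for a function `f` with weak derivative `g`. -/
noncomputable def h1Norm (f g : ℝ → ℝ) : ℝ≥0∞ :=
  (eLpNorm f 2 unitMeasure ^ 2 + eLpNorm g 2 unitMeasure ^ 2) ^ (1 / 2 : ℝ)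

/-- The norm of the Hölder space `C^{1/2}[0,1]`: supremum norm plus Hölder seminorm. -/
noncomputable def holderHalfNorm (f : ℝ → ℝ) : ℝ≥0∞ :=
  (⨆ x ∈ Icc (0 : ℝ) 1, ‖f x‖ₑ) +
    ⨆ x ∈ Icc (0 : ℝ) 1, ⨆ y ∈ Icc (0 : ℝ) 1, ‖f x - f y‖ₑ / ‖x - y‖ₑ ^ (1 / 2 : ℝ)

/-- Global nonnegative `(H¹, L²)` weak solutions `(h, v)` (functions of `t` and then `x`) of
`v_t + v v_x = σ h_xxx + (ν / h) (h v_x)_x`, `h_t = - (h v)_x` on `(0,∞) × (0,1)` with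
`h_x = v = 0` at `x = 0, 1` and `h(0) = h₀`, `v(0) = v₀`; `hx`, `hxx`, `vx` are the weak spatial
derivatives. The class is `h ∈ L^∞_loc([0,∞); H¹) ∩ L²_loc([0,∞); H²)`,
`v ∈ L^∞_loc([0,∞); L²) ∩ L²_loc([0,∞); H¹₀)`. Both equations are required in the weak sense at
every time, the first one multiplied by `h` and, with the help of the second one, written as
`(h v)_t + (h v²)_x = σ h h_xxx + ν (h v_x)_x`, which makes sense also where `h = 0`. -/
structure IsWeakSolution (σ ν : ℝ) (h₀ v₀ : ℝ → ℝ) (h hx hxx v vx : ℝ → ℝ → ℝ) : Prop where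
  /-- The height is nonnegative. -/
  h_nonneg : ∀ t, 0 ≤ t → ∀ x ∈ Icc (0 : ℝ) 1, 0 ≤ h t x
  /-- The representative of `h` is the continuous one, which exists in this class. -/
  h_cont : ContinuousOn (fun p : ℝ × ℝ => h p.1 p.2) (Ici (0 : ℝ) ×ˢ Icc (0 : ℝ) 1)
  /-- `h(t) ∈ H¹(0,1)` with weak derivative `hx t`, locally boundedly in time. -/
  h_H1 : ∀ t, 0 ≤ t → IsH1 (h t) (hx t)
  h_H1_bdd : ∀ T, 0 < T → ∃ C : ℝ, ∀ t ∈ Icc (0 : ℝ) T, ∫ x in (0 : ℝ)..1, hx t x ^ 2 ≤ C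
  /-- `h(t) ∈ H²(0,1)` with `h_x = 0` at the end points, for almost every time. -/
  h_H2 : ∀ᵐ t ∂(volume.restrict (Ici (0 : ℝ))), IsH1Zero (hx t) (hxx t)
  hx_L2 : ∀ T, 0 < T → MemLp (fun p : ℝ × ℝ => hx p.1 p.2) 2 (cylMeasure T)
  hxx_L2 : ∀ T, 0 < T → MemLp (fun p : ℝ × ℝ => hxx p.1 p.2) 2 (cylMeasure T)
  /-- `v(t) ∈ L²(0,1)`, locally boundedly in time. -/
  v_mem : ∀ t, 0 ≤ t → MemLp (v t) 2 unitMeasure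
  v_bdd : ∀ T, 0 < T → ∃ C : ℝ, ∀ t ∈ Icc (0 : ℝ) T, ∫ x in (0 : ℝ)..1, v t x ^ 2 ≤ C
  /-- `v(t) ∈ H¹₀(0,1)` with weak derivative `vx t`, for almost every time. -/
  v_H1 : ∀ᵐ t ∂(volume.restrict (Ici (0 : ℝ))), IsH1Zero (v t) (vx t)
  v_L2 : ∀ T, 0 < T → MemLp (fun p : ℝ × ℝ => v p.1 p.2) 2 (cylMeasure T)
  vx_L2 : ∀ T, 0 < T → MemLp (fun p : ℝ × ℝ => vx p.1 p.2) 2 (cylMeasure T)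
  /-- Initial conditions. -/
  h_init : ∀ x ∈ Icc (0 : ℝ) 1, h 0 x = h₀ x
  v_init : v 0 =ᵐ[unitMeasure] v₀
  /-- `h_t = - (h v)_x`, with no flux through the end points. -/
  mass_eq : ∀ φ : ℝ → ℝ, ContDiff ℝ ∞ φ → ∀ t, 0 ≤ t →
    (∫ x in (0 : ℝ)..1, h t x * φ x) - ∫ x in (0 : ℝ)..1, h₀ x * φ x =
      ∫ s in (0 : ℝ)..t, ∫ x in (0 : ℝ)..1, h s x * v s x * deriv φ x
  /-- `(h v)_t + (h v²)_x = σ h h_xxx + ν (h v_x)_x`; the test function `φ` is supported in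
  `(0,1)`, and the capillary term tested with `φ` is `- σ ∫ h_xx (h φ)_x`. -/
  momentum_eq : ∀ φ : ℝ → ℝ, ContDiff ℝ ∞ φ → tsupport φ ⊆ Ioo (0 : ℝ) 1 → ∀ t, 0 ≤ t →
    (∫ x in (0 : ℝ)..1, h t x * v t x * φ x) - ∫ x in (0 : ℝ)..1, h₀ x * v₀ x * φ x =
      ∫ s in (0 : ℝ)..t, ∫ x in (0 : ℝ)..1,
        (h s x * v s x ^ 2 * deriv φ x
          - σ * (hxx s x * (hx s x * φ x + h s x * deriv φ x))
          - ν * (h s x * vx s x * deriv φ x))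

end ViscousSheet

/-! Write E = ∫ h v² + σ ∫ h_x², twice the energy. Formally E' = -2ν ∫ h v_x², which does not see
h_x, so E alone does not show decay. The remedy is to add a small multiple of X = ∫ h v h_x. With (h
v)_t = -P_x, where P is `stress`, and h_t = -(h v)_x one finds X' = ∫ P h_xx + ∫ ((h v)_x)² = ∫ (h²
v_x² - σ h h_xx² - ν h v_x h_xx). For small ε, Φ = E/2 + ε X lies between E/4 and E, and -Φ'
dominates (ν/2) ∫ h v_x² + (εσ/2) ∫ h h_xx².

This dissipation controls E although h may vanish (`coercivity`). If ∫ h_x² ≤ M²/4, then h ≥ M/2 and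
Poincaré's inequality applies to v and to h_x. Otherwise ∫ h h_xx² ≥ M³/16
(`weighted_curvature_ge`), while E never exceeds a bound N of its initial value. In both cases Φ' ≤
-B Φ.

A weak solution carries no energy inequality by definition and v has no time derivative, so these
computations are done on finite increments. The balances integrated over [t-δ, t] are tested with
v(t), v(t)², h_xx(t) and, for X, also with (h v)_x(t-δ). Convexity makes the increments of the two
parts of E at most the tested quantities; for X there is an exact discrete product rule. Dividing by
δ and integrating in t leaves Steklov averages paired with L² functions, which converge by
continuity of translations in L² (`tendsto_steklov`, `increment_le`). The outcome holds between left
Lebesgue points of the energies, which include almost every time, and time 0 for the inequality for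
E.

On those times `geometric_decay` gives exponential decay of Φ. Both parts of E are suprema of
quantities that are weakly right-continuous in time, so the decay extends to every t
(`kinetic_le_of_ae`, `slopeEnergy_le_of_ae`). The remaining claims follow from one-dimensional
Sobolev bounds; for v in L² one uses that h ≥ M/2 eventually. -/

namespace ViscousSheet

/-! ### Calculus of H¹ functions on the unit interval -/

section

variable {f f' g g' : ℝ → ℝ}

lemma integral_unit (f : ℝ → ℝ) : ∫ x in (0 : ℝ)..1, f x = ∫ x, f x ∂unitMeasure :=
  intervalIntegral.integral_of_le zero_le_one

lemma ae_unit_mem : ∀ᵐ x ∂unitMeasure, x ∈ Ioo (0 : ℝ) 1 := by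
  have h : unitMeasure = volume.restrict (Ioo (0 : ℝ) 1) :=
    (Measure.restrict_congr_set Ioo_ae_eq_Ioc).symm
  rw [h]
  exact ae_restrict_mem measurableSet_Ioo

lemma ae_unit_mem_Icc : ∀ᵐ x ∂unitMeasure, x ∈ Icc (0 : ℝ) 1 :=
  ae_unit_mem.mono fun _ h => Ioo_subset_Icc_self h

instance : IsProbabilityMeasure unitMeasure := ⟨by simp [unitMeasure]⟩

lemma memLp_unit_of_continuousOn {p : ℝ≥0∞} (hf : ContinuousOn f (Icc 0 1)) :
    MemLp f p unitMeasure := by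
  obtain ⟨C, hC⟩ := isCompact_Icc.exists_bound_of_continuousOn hf
  refine MemLp.of_bound ?_ C (ae_unit_mem_Icc.mono hC)
  exact (hf.mono Ioc_subset_Icc_self).aestronglyMeasurable measurableSet_Ioc

lemma MemLp.continuousOn_mul (hg : MemLp g 2 unitMeasure) (hf : ContinuousOn f (Icc 0 1)) :
    MemLp (fun x => f x * g x) 2 unitMeasure :=
  hg.mul' (memLp_unit_of_continuousOn (p := ∞) hf)

lemma Integrable.continuousOn_mul (hg : Integrable g unitMeasure)
    (hf : ContinuousOn f (Icc 0 1)) : Integrable (fun x => f x * g x) unitMeasure := by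
  obtain ⟨C, hC⟩ := isCompact_Icc.exists_bound_of_continuousOn hf
  exact hg.bdd_mul ((hf.mono Ioc_subset_Icc_self).aestronglyMeasurable measurableSet_Ioc)
    (ae_unit_mem_Icc.mono hC)

lemma MemLp.integrable_mul' (hf : MemLp f 2 unitMeasure) (hg : MemLp g 2 unitMeasure) :
    Integrable (fun x => f x * g x) unitMeasure := hf.integrable_mul hg

lemma IsH1.intervalIntegrable (h : IsH1 f f') : IntervalIntegrable f' volume 0 1 :=
  (intervalIntegrable_iff_integrableOn_Ioc_of_le zero_le_one).2 (h.1.integrable one_le_two)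

lemma IsH1.intervalIntegrable' (h : IsH1 f f') {a b : ℝ} (ha : a ∈ Icc (0 : ℝ) 1)
    (hb : b ∈ Icc (0 : ℝ) 1) : IntervalIntegrable f' volume a b := by
  refine h.intervalIntegrable.mono_set ?_
  rw [uIcc_of_le zero_le_one]
  exact uIcc_subset_Icc ha hb

lemma IsH1.sub_eq (h : IsH1 f f') {a b : ℝ} (ha : a ∈ Icc (0 : ℝ) 1)
    (hb : b ∈ Icc (0 : ℝ) 1) : f b - f a = ∫ x in a..b, f' x := by
  have h0 : (0 : ℝ) ∈ Icc (0 : ℝ) 1 := by simp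
  rw [h.2 a ha, h.2 b hb, ← intervalIntegral.integral_add_adjacent_intervals
    (h.intervalIntegrable' h0 ha) (h.intervalIntegrable' ha hb)]
  ring

lemma IsH1.absolutelyContinuous (h : IsH1 f f') : AbsolutelyContinuousOnInterval f 0 1 := by
  have h1 : AbsolutelyContinuousOnInterval (fun x => f 0 + ∫ y in (0 : ℝ)..x, f' y) 0 1 :=
    (LipschitzOnWith.absolutelyContinuousOnInterval
      (LipschitzWith.const (f 0)).lipschitzOnWith).fun_add
    (h.intervalIntegrable.absolutelyContinuousOnInterval_intervalIntegral (c := 0) (by simp))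
  -- `f` equals the primitive only on [0,1], so the two are compared through the ε-δ definition,
  -- which evaluates only there.
  rw [absolutelyContinuousOnInterval_iff] at h1 ⊢
  intro ε hε
  obtain ⟨δ, hδ, H⟩ := h1 ε hε
  refine ⟨δ, hδ, fun E hE hlt => ?_⟩
  have := H E hE hlt
  rwa [Finset.sum_congr rfl] at this
  intro i hi
  have hm := hE.1 i hi
  rw [uIcc_of_le zero_le_one] at hm
  rw [h.2 _ hm.1, h.2 _ hm.2]

lemma IsH1.continuousOn (h : IsH1 f f') : ContinuousOn f (Icc 0 1) := by
  have := h.absolutelyContinuous.continuousOn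
  rwa [uIcc_of_le zero_le_one] at this

lemma IsH1.ae_hasDerivAt (h : IsH1 f f') : ∀ᵐ x ∂unitMeasure, HasDerivAt f (f' x) x := by
  have h1 := h.intervalIntegrable.ae_hasDerivAt_integral
  have h2 := ae_restrict_of_ae (s := Ioc (0 : ℝ) 1) h1
  filter_upwards [h2, ae_unit_mem] with x hx hm
  have h3 := (hx (by rw [uIcc_of_le zero_le_one]; exact Ioo_subset_Icc_self hm) 0
    (by simp)).const_add (f 0)
  refine h3.congr_of_eventuallyEq ?_
  filter_upwards [isOpen_Ioo.mem_nhds hm] with y hy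
  exact h.2 y (Ioo_subset_Icc_self hy)

/-- Weak derivatives are unique almost everywhere; this identifies the slope energy at time 0 with
that of the data. -/
lemma IsH1.ae_eq (hf : IsH1 f f') (hg : IsH1 g g') (hfg : ∀ x ∈ Icc (0 : ℝ) 1, f x = g x) :
    f' =ᵐ[unitMeasure] g' := by
  filter_upwards [hf.ae_hasDerivAt, hg.ae_hasDerivAt, ae_unit_mem] with x h1 h2 hm
  refine h1.unique (h2.congr_of_eventuallyEq ?_)
  filter_upwards [isOpen_Ioo.mem_nhds hm] with y hy
  exact hfg y (Ioo_subset_Icc_self hy)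

lemma IsH1.of_absolutelyContinuous (hf : AbsolutelyContinuousOnInterval f 0 1)
    (h : ∀ᵐ x ∂unitMeasure, HasDerivAt f (f' x) x) (h2 : MemLp f' 2 unitMeasure) : IsH1 f f' := by
  refine ⟨h2, fun x hx => ?_⟩
  have h3 : AbsolutelyContinuousOnInterval f 0 x := hf.mono (by
    rw [uIcc_of_le zero_le_one, uIcc_of_le hx.1]; exact Icc_subset_Icc_right hx.2)
  have h4 := h3.integral_deriv_eq_sub
  have h5 : ∫ y in (0 : ℝ)..x, deriv f y = ∫ y in (0 : ℝ)..x, f' y := by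
    refine intervalIntegral.integral_congr_ae ?_
    have h6 := (ae_restrict_iff' measurableSet_Ioc).1 h
    filter_upwards [h6] with y hy hm
    rw [uIoc_of_le hx.1] at hm
    exact (hy ⟨hm.1, hm.2.trans hx.2⟩).deriv
  linarith

lemma IsH1.mul (hf : IsH1 f f') (hg : IsH1 g g') :
    IsH1 (fun x => f x * g x) (fun x => f' x * g x + f x * g' x) := by
  refine .of_absolutelyContinuous (hf.absolutelyContinuous.fun_mul hg.absolutelyContinuous) ?_ ?_
  · filter_upwards [hf.ae_hasDerivAt, hg.ae_hasDerivAt] with x h1 h2 using h1.mul h2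
  · have h1 := MemLp.continuousOn_mul hf.1 hg.continuousOn
    have h2 := MemLp.continuousOn_mul hg.1 hf.continuousOn
    have h3 := h1.add h2
    refine h3.ae_eq (ae_of_all _ fun x => ?_)
    simp [mul_comm]

lemma IsH1.sub (hf : IsH1 f f') (hg : IsH1 g g') :
    IsH1 (fun x => f x - g x) (fun x => f' x - g' x) :=
  .of_absolutelyContinuous (hf.absolutelyContinuous.fun_sub hg.absolutelyContinuous)
    (by filter_upwards [hf.ae_hasDerivAt, hg.ae_hasDerivAt] with x h1 h2 using h1.sub h2)
    (hf.1.sub hg.1)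

lemma IsH1.of_contDiff {φ : ℝ → ℝ} (h : ContDiff ℝ ∞ φ) : IsH1 φ (deriv φ) := by
  have hc : Continuous (deriv φ) := h.continuous_deriv (by simp)
  refine ⟨memLp_unit_of_continuousOn hc.continuousOn, fun x _ => ?_⟩
  rw [intervalIntegral.integral_deriv_eq_sub]
  · ring
  · intro y _
    exact h.differentiable (by simp) y
  · exact hc.intervalIntegrable _ _

lemma IsH1.integral_deriv (hf : IsH1 f f') : ∫ x, f' x ∂unitMeasure = f 1 - f 0 := by
  rw [← integral_unit, hf.sub_eq (by simp) (by simp)]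

lemma IsH1Zero.integral_deriv (hf : IsH1Zero f f') : ∫ x, f' x ∂unitMeasure = 0 := by
  rw [hf.1.integral_deriv, hf.2.1, hf.2.2, sub_zero]

/-- One factor vanishing at the ends suffices. Every cancellation of an exact derivative below is an
instance of this followed by `IsH1Zero.integral_deriv`. -/
lemma IsH1.mul_zero (hf : IsH1 f f') (hg : IsH1Zero g g') :
    IsH1Zero (fun x => f x * g x) (fun x => f' x * g x + f x * g' x) :=
  ⟨hf.mul hg.1, by simp [hg.2.1], by simp [hg.2.2]⟩

lemma IsH1.integral_by_parts (hf : IsH1 f f') (hg : IsH1Zero g g') :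
    ∫ x, f' x * g x ∂unitMeasure = -∫ x, f x * g' x ∂unitMeasure := by
  have h := (hf.mul_zero hg).integral_deriv
  rw [integral_add] at h
  · linarith
  · simpa [mul_comm] using Integrable.continuousOn_mul (hf.1.integrable one_le_two)
      hg.1.continuousOn
  · exact Integrable.continuousOn_mul (hg.1.1.integrable one_le_two) hf.continuousOn

lemma MemLp.integrable_sq_unit (hf : MemLp f 2 unitMeasure) :
    Integrable (fun x => f x ^ 2) unitMeasure := hf.integrable_sq

lemma sq_integral_le {μ : Measure ℝ} [IsFiniteMeasure μ] (hf : MemLp f 2 μ) :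
    (∫ x, f x ∂μ) ^ 2 ≤ μ.real univ * ∫ x, f x ^ 2 ∂μ := by
  set c := ∫ x, f x ∂μ with hc
  have hi := hf.integrable one_le_two
  have hs := hf.integrable_sq
  have h1 : ∀ l : ℝ, 0 ≤ (∫ x, f x ^ 2 ∂μ) - 2 * l * c + l ^ 2 * μ.real univ := by
    intro l
    have : 0 ≤ ∫ x, (f x - l) ^ 2 ∂μ := integral_nonneg fun x => sq_nonneg _
    have e : ∫ x, (f x - l) ^ 2 ∂μ = ∫ x, (f x ^ 2 - (2 * l) * f x + l ^ 2) ∂μ := by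
      congr 1; ext x; ring
    have hm : Integrable (fun x => (2 * l) * f x) μ := hi.const_mul _
    have hd : Integrable (fun x => f x ^ 2 - (2 * l) * f x) μ := hs.sub hm
    rw [e, integral_add hd (integrable_const _), integral_sub hs hm, integral_const_mul,
      integral_const, smul_eq_mul] at this
    linarith
  have hS : 0 ≤ ∫ x, f x ^ 2 ∂μ := integral_nonneg fun x => sq_nonneg _
  rcases eq_or_lt_of_le (measureReal_nonneg : 0 ≤ μ.real univ) with h0 | hpos
  · have : μ = 0 := by
      rw [eq_comm, measureReal_eq_zero_iff] at h0
      exact Measure.measure_univ_eq_zero.1 h0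
    simp [hc, this]
  -- The mean of `f` minimises the quadratic in `l`; its minimum being nonnegative is Cauchy–Schwarz
  -- against 1.
  · have := h1 (c / μ.real univ)
    have h2 : (∫ x, f x ^ 2 ∂μ) - 2 * (c / μ.real univ) * c + (c / μ.real univ) ^ 2 * μ.real univ
      = (∫ x, f x ^ 2 ∂μ) - c ^ 2 / μ.real univ := by field_simp; ring
    rw [h2, sub_nonneg, div_le_iff₀ hpos] at this
    linarith

lemma IsH1.sq_sub_le (h : IsH1 f f') {a b : ℝ} (ha : a ∈ Icc (0 : ℝ) 1)
    (hb : b ∈ Icc (0 : ℝ) 1) :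
    (f b - f a) ^ 2 ≤ |b - a| * ∫ x, f' x ^ 2 ∂unitMeasure := by
  wlog hab : a ≤ b generalizing a b
  · have := this hb ha (le_of_not_ge hab)
    rw [abs_sub_comm]
    nlinarith
  have hsub : Ioc a b ⊆ Ioc 0 1 := Ioc_subset_Ioc ha.1 hb.2
  have hle : volume.restrict (Ioc a b) ≤ unitMeasure := Measure.restrict_mono hsub le_rfl
  have h1 := sq_integral_le (h.1.mono_measure hle)
  rw [h.sub_eq ha hb, intervalIntegral.integral_of_le hab]
  have h2 : (volume.restrict (Ioc a b)).real univ = |b - a| := by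
    simp [abs_of_nonneg (sub_nonneg.2 hab), hab]
  rw [h2] at h1
  refine h1.trans (mul_le_mul_of_nonneg_left ?_ (abs_nonneg _))
  exact integral_mono_measure hle (ae_of_all _ fun x => sq_nonneg _) h.1.integrable_sq

lemma IsH1.sq_sub_le' (h : IsH1 f f') {a b : ℝ} (ha : a ∈ Icc (0 : ℝ) 1)
    (hb : b ∈ Icc (0 : ℝ) 1) : (f b - f a) ^ 2 ≤ ∫ x, f' x ^ 2 ∂unitMeasure := by
  refine (h.sq_sub_le ha hb).trans ?_
  have h1 : |b - a| ≤ 1 := abs_le.2 ⟨by linarith [ha.2, hb.1], by linarith [ha.1, hb.2]⟩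
  have h2 : 0 ≤ ∫ x, f' x ^ 2 ∂unitMeasure := integral_nonneg fun x => sq_nonneg _
  nlinarith

lemma IsH1Zero.sq_le (h : IsH1Zero f f') {x : ℝ} (hx : x ∈ Icc (0 : ℝ) 1) :
    f x ^ 2 ≤ ∫ x, f' x ^ 2 ∂unitMeasure := by
  have := h.1.sq_sub_le' (a := 0) (by simp) hx
  rwa [h.2.1, sub_zero] at this

lemma IsH1Zero.integral_sq_le (h : IsH1Zero f f') :
    ∫ x, f x ^ 2 ∂unitMeasure ≤ ∫ x, f' x ^ 2 ∂unitMeasure := by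
  have h1 : ∫ x, f x ^ 2 ∂unitMeasure ≤ ∫ _, (∫ x, f' x ^ 2 ∂unitMeasure) ∂unitMeasure := by
    refine integral_mono_ae ?_ (integrable_const _) ?_
    · exact (memLp_unit_of_continuousOn h.1.continuousOn (p := 2)).integrable_sq
    · filter_upwards [ae_unit_mem_Icc] with x hx using h.sq_le hx
  simpa using h1

end

/-! ### Time translations, Steklov averages and Lebesgue points -/

section

/-- Lebesgue measure on `ℝ × (0,1)`. -/
noncomputable abbrev stripMeasure : Measure (ℝ × ℝ) := (volume : Measure ℝ).prod unitMeasure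

/-- Lebesgue measure on `(a,b) × (0,1)`. -/
noncomputable abbrev slabMeasure (a b : ℝ) : Measure (ℝ × ℝ) :=
  (volume.restrict (Ioc a b)).prod unitMeasure

lemma slabMeasure_eq (a b : ℝ) :
    slabMeasure a b = stripMeasure.restrict (Ioc a b ×ˢ univ) := by
  rw [stripMeasure, ← Measure.prod_restrict, Measure.restrict_univ]

lemma slabMeasure_le (a b : ℝ) : slabMeasure a b ≤ stripMeasure := by
  rw [slabMeasure_eq]; exact Measure.restrict_le_self

lemma cylMeasure_eq (T : ℝ) : cylMeasure T = slabMeasure 0 T := by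
  rw [cylMeasure, slabMeasure, Measure.volume_eq_prod, Measure.prod_restrict]

/-- Translation in time. -/
def timeShift (θ : ℝ) : C(ℝ × ℝ, ℝ × ℝ) := ⟨fun z => (z.1 - θ, z.2), by fun_prop⟩

lemma measurePreserving_timeShift (θ : ℝ) :
    MeasurePreserving (timeShift θ) stripMeasure stripMeasure :=
  (measurePreserving_sub_right volume θ).prod (MeasurePreserving.id unitMeasure)

lemma continuous_timeShift : Continuous timeShift := by
  refine ContinuousMap.continuous_of_continuous_uncurry _ ?_
  change Continuous fun p : ℝ × (ℝ × ℝ) => (p.2.1 - p.1, p.2.2)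
  fun_prop

variable {P W : ℝ × ℝ → ℝ}

lemma MemLp.timeShift (hP : MemLp P 2 stripMeasure) (θ : ℝ) :
    MemLp (fun z : ℝ × ℝ => P (z.1 - θ, z.2)) 2 stripMeasure :=
  hP.comp_measurePreserving (measurePreserving_timeShift θ)

/-- The expression is an inner product in L² of the slab, and translation acts continuously on L² of
the strip; hence joint continuity in the two shifts. -/
lemma continuous_setIntegral_timeShift_mul (hP : MemLp P 2 stripMeasure)
    (hW : MemLp W 2 stripMeasure) (a b : ℝ) :
    Continuous fun q : ℝ × ℝ =>
      ∫ z, P (z.1 - q.1, z.2) * W (z.1 - q.2, z.2) ∂slabMeasure a b := by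
  have key : ∀ {F : ℝ × ℝ → ℝ} (hF : MemLp F 2 stripMeasure), Continuous fun θ : ℝ =>
      LpToLpRestrictCLM (ℝ × ℝ) ℝ ℝ stripMeasure 2 (Ioc a b ×ˢ univ)
        ((MemLp.timeShift hF θ).toLp _) := by
    intro F hF
    refine (ContinuousLinearMap.continuous _).comp ?_
    exact Continuous.compMeasurePreservingLp (continuous_const (y := hF.toLp F))
      continuous_timeShift measurePreserving_timeShift (by simp)
  have h := Continuous.inner (𝕜 := ℝ) ((key hP).comp continuous_fst) ((key hW).comp continuous_snd)
  refine h.congr fun q => ?_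
  rw [slabMeasure_eq, L2.inner_def]
  refine integral_congr_ae ?_
  have e : ∀ {F : ℝ × ℝ → ℝ} (hF : MemLp F 2 stripMeasure) (θ : ℝ),
      (LpToLpRestrictCLM (ℝ × ℝ) ℝ ℝ stripMeasure 2 (Ioc a b ×ˢ univ)
        ((MemLp.timeShift hF θ).toLp _)) =ᵐ[stripMeasure.restrict (Ioc a b ×ˢ univ)]
        fun z : ℝ × ℝ => F (z.1 - θ, z.2) := by
    intro F hF θ
    refine (LpToLpRestrictCLM_coeFn ℝ _ _).trans ?_
    exact ae_restrict_of_ae (MemLp.coeFn_toLp _)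
  filter_upwards [e hP q.1, e hW q.2] with z h1 h2
  simp only [Function.comp_apply]
  rw [h1, h2]
  simp [mul_comm]

/-- `P` is determined only almost everywhere, so joint measurability of `P (τ - θ, x)` in the shift
and the point is obtained from this measure-preserving shear. -/
lemma measurePreserving_skew_timeShift (δ : ℝ) :
    MeasurePreserving (fun q : ℝ × (ℝ × ℝ) => (q.1, (q.2.1 - q.1, q.2.2)))
      ((volume.restrict (Ioc 0 δ)).prod stripMeasure)
      ((volume.restrict (Ioc 0 δ)).prod stripMeasure) := by
  refine MeasurePreserving.skew_product (MeasurePreserving.id _)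
    (g := fun (θ : ℝ) (z : ℝ × ℝ) => (z.1 - θ, z.2)) ?_ (ae_of_all _ fun θ => ?_)
  · change Measurable fun p : ℝ × (ℝ × ℝ) => (p.2.1 - p.1, p.2.2)
    fun_prop
  · exact (measurePreserving_timeShift θ).map_eq

lemma integrable_timeShift_mul (hP : MemLp P 2 stripMeasure) (hW : MemLp W 2 stripMeasure)
    (a b δ κ : ℝ) :
    Integrable (fun q : ℝ × (ℝ × ℝ) => P (q.2.1 - q.1, q.2.2) * W (q.2.1 - κ, q.2.2))
      ((volume.restrict (Ioc 0 δ)).prod (slabMeasure a b)) := by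
  have h1 : MemLp (fun q : ℝ × (ℝ × ℝ) => P (q.2.1 - q.1, q.2.2)) 2
      ((volume.restrict (Ioc 0 δ)).prod stripMeasure) :=
    (hP.comp_snd (volume.restrict (Ioc 0 δ))).comp_measurePreserving
      (measurePreserving_skew_timeShift δ)
  have h2 : MemLp (fun q : ℝ × (ℝ × ℝ) => W (q.2.1 - κ, q.2.2)) 2
      ((volume.restrict (Ioc 0 δ)).prod stripMeasure) :=
    (MemLp.timeShift hW κ).comp_snd (volume.restrict (Ioc 0 δ))
  have h3 := h1.integrable_mul h2
  refine h3.mono_measure ?_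
  rw [slabMeasure_eq]
  conv_lhs => rw [← Measure.restrict_univ (μ := volume.restrict (Ioc 0 δ)), Measure.prod_restrict]
  exact Measure.restrict_le_self

lemma integral_sub_interval (P : ℝ × ℝ → ℝ) {δ : ℝ} (hδ : 0 ≤ δ) (τ x : ℝ) :
    ∫ r in (τ - δ)..τ, P (r, x) = ∫ θ, P (τ - θ, x) ∂(volume.restrict (Ioc 0 δ)) := by
  rw [← intervalIntegral.integral_of_le hδ,
    intervalIntegral.integral_comp_sub_left (fun r => P (r, x))]
  simp

lemma steklov_integrable (hP : MemLp P 2 stripMeasure) (hW : MemLp W 2 stripMeasure)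
    (a b κ : ℝ) {δ : ℝ} (hδ : 0 ≤ δ) :
    Integrable (fun z : ℝ × ℝ => (∫ r in (z.1 - δ)..z.1, P (r, z.2)) * W (z.1 - κ, z.2))
      (slabMeasure a b) := by
  have h := (integrable_timeShift_mul hP hW a b δ κ).integral_prod_right
  refine h.congr (ae_of_all _ fun z => ?_)
  simp only
  rw [integral_mul_const, integral_sub_interval P hδ]

/-- The Steklov average of `P`, tested with `W`, is close to `P` tested with `W`. -/
lemma tendsto_steklov (hP : MemLp P 2 stripMeasure) (hW : MemLp W 2 stripMeasure)
    (a b : ℝ) {κ : ℝ → ℝ} (hκ : Tendsto κ (𝓝[>] 0) (𝓝 0)) :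
    Tendsto (fun δ => δ⁻¹ * ∫ z, (∫ r in (z.1 - δ)..z.1, P (r, z.2)) * W (z.1 - κ δ, z.2)
      ∂slabMeasure a b) (𝓝[>] 0) (𝓝 (∫ z, P z * W z ∂slabMeasure a b)) := by
  have hc := continuous_setIntegral_timeShift_mul hP hW a b
  set c : ℝ × ℝ → ℝ := fun q =>
      ∫ z, P (z.1 - q.1, z.2) * W (z.1 - q.2, z.2) ∂slabMeasure a b with hcdef
  have hc0 : c (0, 0) = ∫ z, P z * W z ∂slabMeasure a b := by simp [hcdef]
  -- By Fubini the integrated past of `P` becomes an integral of the correlation `c` over shifts in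
  -- [0,δ]; only continuity of `c` at the origin is then needed.
  have hrw : ∀ δ > 0, ∫ z, (∫ r in (z.1 - δ)..z.1, P (r, z.2)) * W (z.1 - κ δ, z.2)
      ∂slabMeasure a b = ∫ θ in (0 : ℝ)..δ, c (θ, κ δ) := by
    intro δ hδ
    have h := integral_integral_swap
      (f := fun (θ : ℝ) (z : ℝ × ℝ) => P (z.1 - θ, z.2) * W (z.1 - κ δ, z.2))
      (integrable_timeShift_mul hP hW a b δ (κ δ))
    rw [intervalIntegral.integral_of_le hδ.le, hcdef]
    refine Eq.trans ?_ h.symm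
    refine integral_congr_ae (ae_of_all _ fun z => ?_)
    simp only
    rw [integral_mul_const, integral_sub_interval P hδ.le]
  rw [← hc0, Metric.tendsto_nhds]
  intro ε hε
  have h0 : ∀ᶠ q in 𝓝 ((0 : ℝ), (0 : ℝ)), dist (c q) (c (0, 0)) < ε / 2 :=
    Metric.tendsto_nhds.1 (hc.tendsto (0, 0)) (ε / 2) (by positivity)
  obtain ⟨η, hη, H⟩ := Metric.eventually_nhds_iff.1 h0
  have h1 : ∀ᶠ δ in 𝓝[>] (0 : ℝ), dist (κ δ) 0 < η := Metric.tendsto_nhds.1 hκ η hη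
  have h2 : ∀ᶠ δ in 𝓝[>] (0 : ℝ), δ < η := nhdsWithin_le_nhds (eventually_lt_nhds hη)
  filter_upwards [h1, h2, self_mem_nhdsWithin] with δ h1 h2 (hδ : 0 < δ)
  rw [hrw δ hδ]
  have hci : IntervalIntegrable (fun θ => c (θ, κ δ)) volume 0 δ :=
    (hc.comp (by fun_prop : Continuous fun θ : ℝ => (θ, κ δ))).intervalIntegrable _ _
  have e : δ⁻¹ * (∫ θ in (0 : ℝ)..δ, c (θ, κ δ)) - c (0, 0) =
      δ⁻¹ * ∫ θ in (0 : ℝ)..δ, (c (θ, κ δ) - c (0, 0)) := by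
    rw [intervalIntegral.integral_sub hci (by simp)]
    simp
    field_simp
  rw [Real.dist_eq, e, abs_mul, abs_inv, abs_of_pos hδ]
  have hb : ‖∫ θ in (0 : ℝ)..δ, (c (θ, κ δ) - c (0, 0))‖ ≤ (ε / 2) * |δ - 0| := by
    refine intervalIntegral.norm_integral_le_of_norm_le_const fun θ hθ => ?_
    rw [uIoc_of_le hδ.le] at hθ
    refine le_of_lt (H ?_)
    rw [Prod.dist_eq]
    refine max_lt ?_ h1
    rw [Real.dist_eq, sub_zero, abs_of_pos hθ.1]
    exact hθ.2.trans_lt h2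
  rw [sub_zero, abs_of_pos hδ, Real.norm_eq_abs] at hb
  calc δ⁻¹ * |∫ θ in (0 : ℝ)..δ, (c (θ, κ δ) - c (0, 0))| ≤ δ⁻¹ * (ε / 2 * δ) := by gcongr
    _ = ε / 2 := by field_simp
    _ < ε := by linarith

/-- `X` has at `t` a left Lebesgue point with value `X t`. -/
def LeftLebesguePoint (X : ℝ → ℝ) (t : ℝ) : Prop :=
  Tendsto (fun δ => δ⁻¹ * ∫ τ in (t - δ)..t, X τ) (𝓝[>] 0) (𝓝 (X t))

lemma ae_leftLebesguePoint {X : ℝ → ℝ} (hX : LocallyIntegrable X volume) :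
    ∀ᵐ t, LeftLebesguePoint X t := by
  filter_upwards [_root_.LocallyIntegrable.ae_hasDerivAt_integral hX] with t ht
  have h1 := (hasDerivAt_iff_tendsto_slope.1 (ht t))
  have h2 : Tendsto (fun δ : ℝ => t - δ) (𝓝[>] 0) (𝓝[≠] t) := by
    refine tendsto_nhdsWithin_iff.2 ⟨?_, ?_⟩
    · have : Tendsto (fun δ : ℝ => t - δ) (𝓝 0) (𝓝 (t - 0)) := by
        exact (continuous_const.sub continuous_id).tendsto 0
      rw [sub_zero] at this
      exact this.mono_left nhdsWithin_le_nhds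
    · filter_upwards [self_mem_nhdsWithin] with δ (hδ : 0 < δ)
      simp [hδ.ne']
  refine (h1.comp h2).congr fun δ => ?_
  simp only [Function.comp_apply, slope, vsub_eq_sub, smul_eq_mul]
  rw [intervalIntegral.integral_same, intervalIntegral.integral_symm (t - δ) t]
  simp

/-- Meant for time 0: with the energies frozen at their initial values for negative times, 0 is a
Lebesgue point without any continuity of the solution. -/
lemma leftLebesguePoint_of_const {X : ℝ → ℝ} {t : ℝ} (h : ∀ τ ≤ t, X τ = X t) :
    LeftLebesguePoint X t := by
  refine tendsto_const_nhds.congr' ?_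
  filter_upwards [self_mem_nhdsWithin] with δ (hδ : 0 < δ)
  have : ∫ τ in (t - δ)..t, X τ = ∫ τ in (t - δ)..t, X t := by
    refine intervalIntegral.integral_congr fun τ hτ => h τ ?_
    rw [uIcc_of_le (by linarith)] at hτ
    exact hτ.2
  rw [this]
  simp
  field_simp

/-- An upper bound for the increments over short time steps bounds the total increment. -/
lemma sub_le_of_step {X : ℝ → ℝ} (hX : LocallyIntegrable X volume) {a b L : ℝ} (hab : a ≤ b)
    (ha : LeftLebesguePoint X a) (hb : LeftLebesguePoint X b) {R : ℝ → ℝ → ℝ}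
    (hstep : ∀ᶠ δ in 𝓝[>] (0 : ℝ), ∀ᵐ τ ∂(volume.restrict (Ioc a b)), X τ - X (τ - δ) ≤ R δ τ)
    (hint : ∀ᶠ δ in 𝓝[>] (0 : ℝ), Integrable (R δ) (volume.restrict (Ioc a b)))
    (hlim : Tendsto (fun δ => δ⁻¹ * ∫ τ, R δ τ ∂(volume.restrict (Ioc a b))) (𝓝[>] 0) (𝓝 L)) :
    X b - X a ≤ L := by
  have hI : ∀ c d, IntervalIntegrable X volume c d := fun c d =>
    intervalIntegrable_iff.mpr ((hX.integrableOn_isCompact isCompact_uIcc).mono_set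
      uIoc_subset_uIcc)
  refine le_of_tendsto_of_tendsto (hb.sub ha) hlim ?_
  filter_upwards [hstep, hint, self_mem_nhdsWithin] with δ h1 h2 (hδ : 0 < δ)
  have hsh : IntervalIntegrable (fun τ => X (τ - δ)) volume a b := by
    have := (hI (a - δ) (b - δ)).comp_sub_right δ
    simpa using this
  have h3 : ∫ τ in a..b, (X τ - X (τ - δ)) ≤ ∫ τ, R δ τ ∂(volume.restrict (Ioc a b)) := by
    rw [intervalIntegral.integral_of_le hab]
    refine integral_mono_ae ?_ h2 h1
    exact (intervalIntegrable_iff_integrableOn_Ioc_of_le hab).1 ((hI a b).sub hsh)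
  -- Telescoping: only the averages over the last δ before `b` and before `a` survive, which is why
  -- left Lebesgue points are the right notion.
  have h4 : ∫ τ in a..b, (X τ - X (τ - δ)) =
      (∫ τ in (b - δ)..b, X τ) - ∫ τ in (a - δ)..a, X τ := by
    rw [intervalIntegral.integral_sub (hI a b) hsh, intervalIntegral.integral_comp_sub_right]
    have e1 := intervalIntegral.integral_add_adjacent_intervals (hI (a - δ) a) (hI a b)
    have e2 := intervalIntegral.integral_add_adjacent_intervals (hI (a - δ) (b - δ)) (hI (b - δ) b)
    linarith
  rw [← mul_sub, ← h4]
  exact mul_le_mul_of_nonneg_left h3 (by positivity)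

end

/-! ### Test functions, density in L² and the du Bois-Reymond lemma -/

section

/-- Smooth functions with compact support in `(0,1)`. -/
def IsTest (φ : ℝ → ℝ) : Prop :=
  ContDiff ℝ ∞ φ ∧ HasCompactSupport φ ∧ tsupport φ ⊆ Ioo (0 : ℝ) 1

lemma isCompact_of_tsupport_subset {φ : ℝ → ℝ} (h : tsupport φ ⊆ Ioo (0 : ℝ) 1) :
    HasCompactSupport φ :=
  isCompact_Icc.of_isClosed_subset (isClosed_tsupport φ) (h.trans Ioo_subset_Icc_self)

lemma IsTest.continuous {φ : ℝ → ℝ} (h : IsTest φ) : Continuous φ := h.1.continuous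

lemma IsTest.memLp {φ : ℝ → ℝ} (h : IsTest φ) {p : ℝ≥0∞} : MemLp φ p unitMeasure :=
  memLp_unit_of_continuousOn h.continuous.continuousOn

lemma IsTest.isH1Zero {φ : ℝ → ℝ} (h : IsTest φ) : IsH1Zero φ (deriv φ) := by
  refine ⟨.of_contDiff h.1, ?_, ?_⟩
  · exact image_eq_zero_of_notMem_tsupport fun hm => by simpa using h.2.2 hm
  · exact image_eq_zero_of_notMem_tsupport fun hm => by simpa using h.2.2 hm

lemma integral_smul_eq_unit {f φ : ℝ → ℝ} (h : IsTest φ) :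
    ∫ x, φ x • f x = ∫ x, φ x * f x ∂unitMeasure := by
  refine (setIntegral_eq_integral_of_forall_compl_eq_zero fun x hx => ?_).symm
  rw [image_eq_zero_of_notMem_tsupport fun hm => hx (Ioo_subset_Ioc_self (h.2.2 hm)), zero_smul]

lemma ae_eq_zero_of_test {f : ℝ → ℝ} (hf : Integrable f unitMeasure)
    (h : ∀ φ, IsTest φ → ∫ x, φ x * f x ∂unitMeasure = 0) : f =ᵐ[unitMeasure] 0 := by
  have hl : LocallyIntegrableOn f (Ioo 0 1) volume := by
    have : IntegrableOn f (Ioc 0 1) volume := hf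
    exact (this.mono_set Ioo_subset_Ioc_self).locallyIntegrableOn
  have h1 := isOpen_Ioo.ae_eq_zero_of_integral_contDiff_smul_eq_zero hl
    fun φ h1 h2 h3 => (integral_smul_eq_unit ⟨h1, h2, h3⟩).trans (h φ ⟨h1, h2, h3⟩)
  filter_upwards [ae_restrict_of_ae (s := Ioc (0 : ℝ) 1) h1, ae_unit_mem] with x h2 h3
  exact h2 h3

/-- The functions that are almost everywhere equal to a test function. -/
noncomputable def testSubmodule : Submodule ℝ (Lp ℝ 2 unitMeasure) where
  carrier := {f | ∃ φ, IsTest φ ∧ f =ᵐ[unitMeasure] φ}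
  zero_mem' := ⟨0, ⟨contDiff_const, HasCompactSupport.zero, by
    rw [tsupport_eq_empty_iff.2 rfl]; exact empty_subset _⟩, Lp.coeFn_zero _ _ _⟩
  add_mem' := by
    rintro f g ⟨φ, h1, h2⟩ ⟨ψ, h3, h4⟩
    refine ⟨φ + ψ, ⟨h1.1.add h3.1, h1.2.1.add h3.2.1, ?_⟩, ?_⟩
    · exact (tsupport_add φ ψ).trans (union_subset h1.2.2 h3.2.2)
    · exact (Lp.coeFn_add f g).trans (h2.add h4)
  smul_mem' := by
    rintro c f ⟨φ, h1, h2⟩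
    refine ⟨c • φ, ⟨contDiff_const.smul h1.1, h1.2.1.smul_left (f := fun _ => c), ?_⟩, ?_⟩
    · exact (tsupport_smul_subset_right (fun _ => c) φ).trans h1.2.2
    · exact (Lp.coeFn_smul c f).trans (h2.const_smul c)

/-- By the fundamental lemma of the calculus of variations the orthogonal complement is trivial. -/
lemma testSubmodule_dense : testSubmodule.topologicalClosure = ⊤ := by
  rw [Submodule.topologicalClosure_eq_top_iff, Submodule.eq_bot_iff]
  intro f hf
  rw [Submodule.mem_orthogonal] at hf
  have h0 : f =ᵐ[unitMeasure] 0 := by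
    refine ae_eq_zero_of_test ((Lp.memLp f).integrable one_le_two) fun φ hφ => ?_
    have h1 := hf (hφ.memLp.toLp φ) ⟨φ, hφ, MemLp.coeFn_toLp _⟩
    rw [L2.inner_def] at h1
    rw [← h1]
    refine integral_congr_ae ?_
    filter_upwards [MemLp.coeFn_toLp (hφ.memLp (p := 2))] with x hx
    rw [hx]
    simp [mul_comm]
  exact Lp.ext (h0.trans (Lp.coeFn_zero _ _ _).symm)

lemma exists_test_integral_sq_sub_le {f : ℝ → ℝ} (hf : MemLp f 2 unitMeasure) {ε : ℝ} (hε : 0 < ε) :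
    ∃ φ, IsTest φ ∧ ∫ x, (f x - φ x) ^ 2 ∂unitMeasure ≤ ε := by
  have h1 : hf.toLp f ∈ closure (testSubmodule : Set (Lp ℝ 2 unitMeasure)) := by
    rw [← Submodule.topologicalClosure_coe, testSubmodule_dense]
    trivial
  obtain ⟨g, ⟨φ, hφ, hg⟩, hd⟩ := Metric.mem_closure_iff.1 h1 (√ε) (by positivity)
  refine ⟨φ, hφ, ?_⟩
  have h2 : ‖hf.toLp f - g‖ ^ 2 = ∫ x, (f x - φ x) ^ 2 ∂unitMeasure := by
    rw [← real_inner_self_eq_norm_sq, L2.inner_def]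
    refine integral_congr_ae ?_
    filter_upwards [Lp.coeFn_sub (hf.toLp f) g, hg, hf.coeFn_toLp] with x h3 h4 h5
    rw [h3, Pi.sub_apply, h4, h5]
    simp [sq]
  rw [← h2]
  rw [dist_eq_norm] at hd
  calc ‖hf.toLp f - g‖ ^ 2 ≤ √ε ^ 2 := by gcongr
    _ = ε := Real.sq_sqrt hε.le

lemma exists_test_integral_one : ∃ ρ, IsTest ρ ∧ ∫ x, ρ x ∂unitMeasure = 1 := by
  let b : ContDiffBump (1 / 2 : ℝ) := ⟨1 / 8, 1 / 4, by norm_num, by norm_num⟩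
  have hs : tsupport (b.normed volume) ⊆ Ioo (0 : ℝ) 1 := by
    rw [b.tsupport_normed_eq, Real.closedBall_eq_Icc]
    exact Icc_subset_Ioo (by norm_num [b]) (by norm_num [b])
  have ht : IsTest (b.normed volume) := ⟨b.contDiff_normed, b.hasCompactSupport_normed, hs⟩
  refine ⟨_, ht, ?_⟩
  have := integral_smul_eq_unit (f := fun _ => 1) ht
  simp only [smul_eq_mul, mul_one] at this
  rw [← this, b.integral_normed]

/-- The primitive from 0 vanishes to the left of the support of `ψ`, and to its right because the
total integral is zero. -/
lemma IsTest.exists_primitive {ψ : ℝ → ℝ} (h : IsTest ψ) (h0 : ∫ x, ψ x ∂unitMeasure = 0) :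
    ∃ φ, IsTest φ ∧ deriv φ = ψ := by
  have hd : ∀ x, HasDerivAt (fun x => ∫ y in (0 : ℝ)..x, ψ y) (ψ x) x := fun x =>
    (h.continuous.integral_hasStrictDerivAt 0 x).hasDerivAt
  have hder : deriv (fun x => ∫ y in (0 : ℝ)..x, ψ y) = ψ := funext fun x => (hd x).deriv
  have hz : ∀ x, x ∉ Ioo (0 : ℝ) 1 → ψ x = 0 := fun x hx =>
    image_eq_zero_of_notMem_tsupport fun hm => hx (h.2.2 hm)
  have hsm : ContDiff ℝ ∞ (fun x => ∫ y in (0 : ℝ)..x, ψ y) := by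
    rw [contDiff_infty_iff_deriv, hder]
    exact ⟨fun x => (hd x).differentiableAt, h.1⟩
  -- the support of the primitive lies in an interval containing the support of `ψ`
  have hex : ∃ a b : ℝ, 0 < a ∧ b < 1 ∧ tsupport ψ ⊆ Icc a b := by
    rcases (tsupport ψ).eq_empty_or_nonempty with he | hne
    · exact ⟨1 / 2, 1 / 2, by norm_num, by norm_num, by simp [he]⟩
    · have hc : IsCompact (tsupport ψ) := h.2.1
      obtain ⟨a, ha, ha'⟩ := hc.exists_isLeast hne
      obtain ⟨b, hb, hb'⟩ := hc.exists_isGreatest hne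
      exact ⟨a, b, (h.2.2 ha).1, (h.2.2 hb).2, fun x hx => ⟨ha' hx, hb' hx⟩⟩
  obtain ⟨a, b, ha, hb, hab⟩ := hex
  have hsupp : tsupport (fun x => ∫ y in (0 : ℝ)..x, ψ y) ⊆ Icc a b := by
    refine closure_minimal (fun x hx => ?_) isClosed_Icc
    by_contra hnot
    refine hx ?_
    have hzz : ∀ y, y ∉ Icc a b → ψ y = 0 := fun y hy =>
      image_eq_zero_of_notMem_tsupport fun hm => hy (hab hm)
    rcases lt_or_ge x a with hxa | hxa
    · refine (intervalIntegral.integral_congr (g := fun _ => 0) fun y hy => ?_).trans (by simp)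
      refine hzz y fun hm => ?_
      rw [mem_uIcc] at hy
      rcases hy with hy | hy <;> linarith [hm.1]
    · have hxb : b < x := by
        by_contra hh
        exact hnot ⟨hxa, not_lt.1 hh⟩
      have e1 : ∫ y in (1 : ℝ)..x, ψ y = 0 := by
        refine (intervalIntegral.integral_congr (g := fun _ => 0) fun y hy => ?_).trans (by simp)
        refine hzz y fun hm => ?_
        rw [mem_uIcc] at hy
        rcases hy with hy | hy <;> linarith [hm.2]
      have e2 : ∫ y in (0 : ℝ)..1, ψ y = 0 := by rw [integral_unit, h0]
      change ∫ y in (0 : ℝ)..x, ψ y = 0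
      rw [← intervalIntegral.integral_add_adjacent_intervals
        (h.continuous.intervalIntegrable 0 1) (h.continuous.intervalIntegrable 1 x), e1, e2,
        add_zero]
  have hs : tsupport (fun x => ∫ y in (0 : ℝ)..x, ψ y) ⊆ Ioo (0 : ℝ) 1 :=
    hsupp.trans (Icc_subset_Ioo ha hb)
  exact ⟨_, ⟨hsm, isCompact_of_tsupport_subset hs, hs⟩, hder⟩

/-- Du Bois-Reymond: subtracting from a test function a multiple of a fixed bump `ρ` of mass one
makes its integral zero, hence makes it the derivative of a test function. So `f - c` annihilates
all test functions for `c = ∫ ρ f`. -/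
lemma ae_const_of_integral_deriv_test {f : ℝ → ℝ} (hf : MemLp f 2 unitMeasure)
    (h : ∀ φ, IsTest φ → ∫ x, f x * deriv φ x ∂unitMeasure = 0) :
    ∃ c, f =ᵐ[unitMeasure] fun _ => c := by
  obtain ⟨ρ, hρ, hρ1⟩ := exists_test_integral_one
  set c := ∫ x, ρ x * f x ∂unitMeasure with hc
  refine ⟨c, ?_⟩
  have hfi : Integrable f unitMeasure := hf.integrable one_le_two
  have h0 : (fun x => f x - c) =ᵐ[unitMeasure] 0 := by
    refine ae_eq_zero_of_test (hfi.sub (integrable_const c)) fun ψ hψ => ?_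
    set d := ∫ x, ψ x ∂unitMeasure with hd
    have hi : Integrable ψ unitMeasure := hψ.memLp.integrable (q := 2) one_le_two
    have hi' : Integrable ρ unitMeasure := hρ.memLp.integrable (q := 2) one_le_two
    have hψ' : IsTest (ψ - d • ρ) := by
      refine ⟨hψ.1.sub (contDiff_const.smul hρ.1), ?_, ?_⟩
      · exact hψ.2.1.sub (hρ.2.1.smul_left (f := fun _ => d))
      · refine (tsupport_sub ψ (d • ρ)).trans (union_subset hψ.2.2 ?_)
        exact (tsupport_smul_subset_right (fun _ => d) ρ).trans hρ.2.2
    have hz : ∫ x, (ψ - d • ρ) x ∂unitMeasure = 0 := by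
      simp only [Pi.sub_apply, Pi.smul_apply, smul_eq_mul]
      rw [integral_sub hi (hi'.const_mul d), integral_const_mul, hρ1]
      simp [hd]
    obtain ⟨φ, hφ, hder⟩ := hψ'.exists_primitive hz
    have h1 := h φ hφ
    rw [hder] at h1
    have hfψ : Integrable (fun x => ψ x * f x) unitMeasure :=
      MemLp.integrable_mul' hψ.memLp hf
    have hfρ : Integrable (fun x => d * (ρ x * f x)) unitMeasure :=
      (MemLp.integrable_mul' hρ.memLp hf).const_mul d
    have h2 : ∫ x, f x * (ψ - d • ρ) x ∂unitMeasure =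
        (∫ x, ψ x * f x ∂unitMeasure) - d * c := by
      rw [hc, ← integral_const_mul, ← integral_sub hfψ hfρ]
      refine integral_congr_ae (ae_of_all _ fun x => ?_)
      simp only [Pi.sub_apply, Pi.smul_apply, smul_eq_mul]
      ring
    have h3 : ∫ x, ψ x * (f x - c) ∂unitMeasure = (∫ x, ψ x * f x ∂unitMeasure) - d * c := by
      rw [hd, ← integral_mul_const, ← integral_sub hfψ (hi.mul_const c)]
      refine integral_congr_ae (ae_of_all _ fun x => ?_)
      simp only
      ring
    rw [h3, ← h2, h1]
  filter_upwards [h0] with x hx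
  have : f x - c = 0 := hx
  linarith

/-- A weak identity tested with smooth functions extends to test functions in `H¹₀`. -/
lemma integral_eq_of_test {u p w w' : ℝ → ℝ} (hu : MemLp u 2 unitMeasure)
    (hp : MemLp p 2 unitMeasure)
    (h : ∀ φ, IsTest φ → ∫ x, u x * φ x ∂unitMeasure = ∫ x, p x * deriv φ x ∂unitMeasure)
    (hw : IsH1Zero w w') :
    ∫ x, u x * w x ∂unitMeasure = ∫ x, p x * w' x ∂unitMeasure := by
  -- With `U` a primitive of `u`, the hypothesis says that `p + U` has zero weak derivative, so it
  -- is constant, and constants are orthogonal to `w'`. No density of test functions in H¹₀ is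
  -- required.
  set U : ℝ → ℝ := fun x => ∫ y in (0 : ℝ)..x, u y with hUdef
  have hU : IsH1 U u := ⟨hu, fun x _ => by simp [hUdef]⟩
  have hUm : MemLp U 2 unitMeasure := memLp_unit_of_continuousOn hU.continuousOn
  obtain ⟨c, hc⟩ := ae_const_of_integral_deriv_test (hp.add hUm) fun φ hφ => by
    have h1 := hU.integral_by_parts hφ.isH1Zero
    have h2 := h φ hφ
    have e : ∫ x, (p + U) x * deriv φ x ∂unitMeasure =
        (∫ x, p x * deriv φ x ∂unitMeasure) + ∫ x, U x * deriv φ x ∂unitMeasure := by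
      rw [← integral_add (MemLp.integrable_mul' hp hφ.isH1Zero.1.1)
        (MemLp.integrable_mul' hUm hφ.isH1Zero.1.1)]
      refine integral_congr_ae (ae_of_all _ fun x => ?_)
      simp only [Pi.add_apply]
      ring
    rw [e]
    linarith
  have h1 := hU.integral_by_parts hw
  have h3 : ∫ x, p x * w' x ∂unitMeasure =
      ∫ x, (c * w' x - U x * w' x) ∂unitMeasure := by
    refine integral_congr_ae ?_
    filter_upwards [hc] with x hx
    have : p x + U x = c := hx
    rw [← this]
    ring
  rw [h3, integral_sub ((hw.1.1.integrable one_le_two).const_mul c)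
    (MemLp.integrable_mul' hUm hw.1.1), integral_const_mul, hw.integral_deriv, h1]
  ring

end

/-! ### Integrability of the nonlinear terms and the balances integrated in time -/

section

section Slab

variable {a b : ℝ} {F : ℝ → ℝ → ℝ}

lemma memLp_slice (hF : MemLp (fun p : ℝ × ℝ => F p.1 p.2) 2 (slabMeasure a b)) :
    ∀ᵐ t ∂(volume.restrict (Ioc a b)), MemLp (F t) 2 unitMeasure := by
  filter_upwards [hF.aestronglyMeasurable.prodMk_left, hF.integrable_sq.prod_right_ae]
    with t h1 h2
  exact (memLp_two_iff_integrable_sq h1).2 h2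

lemma memLp_slice' (hF : MemLp (fun p : ℝ × ℝ => F p.1 p.2) 2 (slabMeasure a b)) :
    ∀ᵐ x ∂unitMeasure, MemLp (fun t => F t x) 2 (volume.restrict (Ioc a b)) := by
  have h0 : MemLp (fun p : ℝ × ℝ => F p.2 p.1) 2 (unitMeasure.prod (volume.restrict (Ioc a b))) :=
    hF.comp_measurePreserving Measure.measurePreserving_swap
  filter_upwards [h0.aestronglyMeasurable.prodMk_left, h0.integrable_sq.prod_right_ae]
    with t h1 h2
  exact (memLp_two_iff_integrable_sq h1).2 h2

lemma memLp_time_integral (hab : a ≤ b)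
    (hF : MemLp (fun p : ℝ × ℝ => F p.1 p.2) 2 (slabMeasure a b)) :
    MemLp (fun x => ∫ r in a..b, F r x) 2 unitMeasure := by
  have hm : AEStronglyMeasurable (fun x => ∫ r in a..b, F r x) unitMeasure := by
    simp_rw [intervalIntegral.integral_of_le hab]
    exact (hF.aestronglyMeasurable.comp_measurePreserving
      (Measure.measurePreserving_swap)).integral_prod_right'
  rw [memLp_two_iff_integrable_sq hm]
  refine Integrable.mono' (hF.integrable_sq.integral_prod_right.const_mul (b - a)) (hm.pow 2) ?_
  filter_upwards [memLp_slice' hF] with x hx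
  rw [Real.norm_of_nonneg (sq_nonneg _), intervalIntegral.integral_of_le hab]
  have := sq_integral_le hx
  simpa [hab] using this

lemma integral_time_integral_mul (hab : a ≤ b)
    (hF : MemLp (fun p : ℝ × ℝ => F p.1 p.2) 2 (slabMeasure a b)) {w : ℝ → ℝ}
    (hw : MemLp w 2 unitMeasure) :
    ∫ r in a..b, ∫ x, F r x * w x ∂unitMeasure =
      ∫ x, (∫ r in a..b, F r x) * w x ∂unitMeasure := by
  have hi : Integrable (fun p : ℝ × ℝ => F p.1 p.2 * w p.2) (slabMeasure a b) :=
    hF.integrable_mul (hw.comp_snd (volume.restrict (Ioc a b)))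
  simp_rw [intervalIntegral.integral_of_le hab]
  rw [integral_integral_swap (f := fun r x => F r x * w x) hi]
  simp_rw [integral_mul_const]

lemma intervalIntegrable_slab {f : ℝ × ℝ → ℝ} (hab : a ≤ b) (hf : Integrable f (slabMeasure a b)) :
    IntervalIntegrable (fun r => ∫ x, f (r, x) ∂unitMeasure) volume a b :=
  (intervalIntegrable_iff_integrableOn_Ioc_of_le hab).2 hf.integral_prod_left

/-- The product of `u ∈ L²(H¹₀)` and `w ∈ L^∞(L²)` is in `L²(L²)`. -/
lemma memLp_mul_of_slices {u ux w : ℝ → ℝ → ℝ} {C : ℝ}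
    (hu : MemLp (fun p : ℝ × ℝ => u p.1 p.2) 2 (slabMeasure a b))
    (hux : MemLp (fun p : ℝ × ℝ => ux p.1 p.2) 2 (slabMeasure a b))
    (hw : MemLp (fun p : ℝ × ℝ => w p.1 p.2) 2 (slabMeasure a b))
    (hz : ∀ᵐ t ∂(volume.restrict (Ioc a b)), IsH1Zero (u t) (ux t))
    (hC : ∀ᵐ t ∂(volume.restrict (Ioc a b)), ∫ x, w t x ^ 2 ∂unitMeasure ≤ C) :
    MemLp (fun p : ℝ × ℝ => u p.1 p.2 * w p.1 p.2) 2 (slabMeasure a b) := by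
  have hm : AEStronglyMeasurable (fun p : ℝ × ℝ => u p.1 p.2 * w p.1 p.2) (slabMeasure a b) :=
    hu.aestronglyMeasurable.mul hw.aestronglyMeasurable
  have hws := memLp_slice hw
  have hm2 : AEStronglyMeasurable (fun p : ℝ × ℝ => (u p.1 p.2 * w p.1 p.2) ^ 2)
      (slabMeasure a b) := hm.pow 2
  rw [memLp_two_iff_integrable_sq hm, integrable_prod_iff hm2]
  constructor
  · filter_upwards [hz, hws] with t h1 h2
    exact (MemLp.continuousOn_mul h2 h1.1.continuousOn).integrable_sq
  · refine Integrable.mono' (hux.integrable_sq.integral_prod_left.mul_const C)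
      hm2.norm.integral_prod_right' ?_
    filter_upwards [hz, hws, hC] with t h1 h2 h3
    rw [Real.norm_of_nonneg (integral_nonneg fun x => norm_nonneg _)]
    have h4 : 0 ≤ ∫ x, ux t x ^ 2 ∂unitMeasure := integral_nonneg fun x => sq_nonneg _
    calc ∫ x, ‖(u t x * w t x) ^ 2‖ ∂unitMeasure
        ≤ ∫ x, (∫ y, ux t y ^ 2 ∂unitMeasure) * w t x ^ 2 ∂unitMeasure := by
          refine integral_mono_ae ?_ (h2.integrable_sq.const_mul _) ?_
          · exact (MemLp.continuousOn_mul h2 h1.1.continuousOn).integrable_sq.norm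
          · filter_upwards [ae_unit_mem_Icc] with x hx
            rw [Real.norm_of_nonneg (sq_nonneg _), mul_pow]
            exact mul_le_mul_of_nonneg_right (h1.sq_le hx) (sq_nonneg _)
      _ = (∫ y, ux t y ^ 2 ∂unitMeasure) * ∫ x, w t x ^ 2 ∂unitMeasure := integral_const_mul _ _
      _ ≤ (∫ y, ux t y ^ 2 ∂unitMeasure) * C := by gcongr

end Slab

/-- The spatial derivative of the momentum density `h v`. -/
def momentumDeriv (h hx v vx : ℝ → ℝ → ℝ) (t x : ℝ) : ℝ := hx t x * v t x + h t x * vx t x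

/-- The flux of momentum: `(h v)_t = - (stress)_x`, up to sign. -/
noncomputable def stress (σ ν : ℝ) (h hx hxx v vx : ℝ → ℝ → ℝ) (t x : ℝ) : ℝ :=
  h t x * v t x ^ 2 - σ * (h t x * hxx t x) + σ / 2 * hx t x ^ 2 - ν * (h t x * vx t x)

namespace IsWeakSolution

variable {σ ν : ℝ} {h₀ v₀ : ℝ → ℝ} {h hx hxx v vx : ℝ → ℝ → ℝ}

/-- The times at which both unknowns have their full spatial regularity. -/
def Regular (hx hxx v vx : ℝ → ℝ → ℝ) (t : ℝ) : Prop :=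
  IsH1Zero (hx t) (hxx t) ∧ IsH1Zero (v t) (vx t)

lemma ae_regular (S : IsWeakSolution σ ν h₀ v₀ h hx hxx v vx) {a : ℝ} (ha : 0 ≤ a) (b : ℝ) :
    ∀ᵐ t ∂(volume.restrict (Ioc a b)), Regular hx hxx v vx t := by
  have h1 : volume.restrict (Ioc a b) ≤ volume.restrict (Ici (0 : ℝ)) :=
    Measure.restrict_mono (fun t ht => ha.trans ht.1.le) le_rfl
  exact (ae_mono h1) (S.h_H2.and S.v_H1)

lemma ae_nonneg_time {a : ℝ} (ha : 0 ≤ a) (b : ℝ) :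
    ∀ᵐ t ∂(volume.restrict (Ioc a b)), a < t ∧ t ≤ b ∧ 0 ≤ t := by
  filter_upwards [ae_restrict_mem measurableSet_Ioc] with t ht
  exact ⟨ht.1, ht.2, ha.trans ht.1.le⟩

lemma height_continuousOn (S : IsWeakSolution σ ν h₀ v₀ h hx hxx v vx) {t : ℝ} (ht : 0 ≤ t) :
    ContinuousOn (h t) (Icc 0 1) := (S.h_H1 t ht).continuousOn

lemma exists_height_le (S : IsWeakSolution σ ν h₀ v₀ h hx hxx v vx) (T : ℝ) :
    ∃ C, ∀ t ∈ Icc 0 T, ∀ x ∈ Icc (0 : ℝ) 1, h t x ≤ C := by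
  have hK : IsCompact (Icc (0 : ℝ) T ×ˢ Icc (0 : ℝ) 1) := isCompact_Icc.prod isCompact_Icc
  obtain ⟨C, hC⟩ := hK.exists_bound_of_continuousOn
    (S.h_cont.mono (prod_mono_left Icc_subset_Ici_self))
  exact ⟨C, fun t ht x hx => (le_abs_self _).trans (hC (t, x) ⟨ht, hx⟩)⟩

lemma height_memLp_top (S : IsWeakSolution σ ν h₀ v₀ h hx hxx v vx) (T : ℝ) :
    MemLp (fun p : ℝ × ℝ => h p.1 p.2) ∞ (slabMeasure 0 T) := by
  have hsub : Ioc (0 : ℝ) T ×ˢ Ioc (0 : ℝ) 1 ⊆ Icc (0 : ℝ) T ×ˢ Icc (0 : ℝ) 1 :=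
    prod_mono Ioc_subset_Icc_self Ioc_subset_Icc_self
  obtain ⟨C, hC⟩ := S.exists_height_le T
  rw [← cylMeasure_eq]
  have hms : MeasurableSet (Ioc (0 : ℝ) T ×ˢ Ioc (0 : ℝ) 1) :=
    measurableSet_Ioc.prod measurableSet_Ioc
  refine memLp_top_of_bound ?_ C ?_
  · refine ContinuousOn.aestronglyMeasurable ?_ hms
    exact S.h_cont.mono (hsub.trans (prod_mono_left Icc_subset_Ici_self))
  · filter_upwards [ae_restrict_mem hms] with p hp
    have := hsub hp
    rw [Real.norm_of_nonneg (S.h_nonneg _ this.1.1 _ this.2)]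
    exact hC _ this.1 _ this.2

lemma memLp_height_mul (S : IsWeakSolution σ ν h₀ v₀ h hx hxx v vx) {T : ℝ} {F : ℝ × ℝ → ℝ}
    (hF : MemLp F 2 (slabMeasure 0 T)) :
    MemLp (fun p : ℝ × ℝ => h p.1 p.2 * F p) 2 (slabMeasure 0 T) :=
  hF.mul' (S.height_memLp_top T)

lemma memLp_of_cyl {F : ℝ × ℝ → ℝ} (hF : ∀ T, 0 < T → MemLp F 2 (cylMeasure T)) (T : ℝ) :
    MemLp F 2 (slabMeasure 0 T) := by
  rcases le_or_gt T 0 with hT | hT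
  · have : slabMeasure 0 T = 0 := by simp [slabMeasure, hT]
    rw [this]
    exact MemLp.of_bound (by simp) 0 (by simp)
  · rw [← cylMeasure_eq]; exact hF T hT

lemma ae_velocity_sq_le (S : IsWeakSolution σ ν h₀ v₀ h hx hxx v vx) (T : ℝ) :
    ∃ C, ∀ᵐ t ∂(volume.restrict (Ioc 0 T)), ∫ x, v t x ^ 2 ∂unitMeasure ≤ C := by
  rcases le_or_gt T 0 with hT | hT
  · exact ⟨0, by simp [hT]⟩
  · obtain ⟨C, hC⟩ := S.v_bdd T hT
    refine ⟨C, ?_⟩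
    filter_upwards [ae_restrict_mem measurableSet_Ioc] with t ht
    rw [← integral_unit]
    exact hC t (Ioc_subset_Icc_self ht)

lemma ae_slope_sq_le (S : IsWeakSolution σ ν h₀ v₀ h hx hxx v vx) (T : ℝ) :
    ∃ C, ∀ᵐ t ∂(volume.restrict (Ioc 0 T)), ∫ x, hx t x ^ 2 ∂unitMeasure ≤ C := by
  rcases le_or_gt T 0 with hT | hT
  · exact ⟨0, by simp [hT]⟩
  · obtain ⟨C, hC⟩ := S.h_H1_bdd T hT
    refine ⟨C, ?_⟩
    filter_upwards [ae_restrict_mem measurableSet_Ioc] with t ht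
    rw [← integral_unit]
    exact hC t (Ioc_subset_Icc_self ht)

/-- The quadratic terms lie in L² of the cylinder by `memLp_mul_of_slices`. Hence `stress` and
`momentumDeriv` do too, and all their pairings with v², v_x and h_xx are integrable. -/
lemma memLp_velocity_sq (S : IsWeakSolution σ ν h₀ v₀ h hx hxx v vx) (T : ℝ) :
    MemLp (fun p : ℝ × ℝ => v p.1 p.2 ^ 2) 2 (slabMeasure 0 T) := by
  obtain ⟨C, hC⟩ := S.ae_velocity_sq_le T
  simp_rw [sq]
  exact memLp_mul_of_slices (memLp_of_cyl S.v_L2 T) (memLp_of_cyl S.vx_L2 T)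
    (memLp_of_cyl S.v_L2 T) ((S.ae_regular le_rfl T).mono fun t ht => ht.2) hC

lemma memLp_slope_sq (S : IsWeakSolution σ ν h₀ v₀ h hx hxx v vx) (T : ℝ) :
    MemLp (fun p : ℝ × ℝ => hx p.1 p.2 ^ 2) 2 (slabMeasure 0 T) := by
  obtain ⟨C, hC⟩ := S.ae_slope_sq_le T
  simp_rw [sq]
  exact memLp_mul_of_slices (memLp_of_cyl S.hx_L2 T) (memLp_of_cyl S.hxx_L2 T)
    (memLp_of_cyl S.hx_L2 T) ((S.ae_regular le_rfl T).mono fun t ht => ht.1) hC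

lemma memLp_slope_mul_velocity (S : IsWeakSolution σ ν h₀ v₀ h hx hxx v vx) (T : ℝ) :
    MemLp (fun p : ℝ × ℝ => hx p.1 p.2 * v p.1 p.2) 2 (slabMeasure 0 T) := by
  obtain ⟨C, hC⟩ := S.ae_velocity_sq_le T
  exact memLp_mul_of_slices (memLp_of_cyl S.hx_L2 T) (memLp_of_cyl S.hxx_L2 T)
    (memLp_of_cyl S.v_L2 T) ((S.ae_regular le_rfl T).mono fun t ht => ht.1) hC

lemma memLp_momentumDeriv (S : IsWeakSolution σ ν h₀ v₀ h hx hxx v vx) (T : ℝ) :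
    MemLp (fun p : ℝ × ℝ => momentumDeriv h hx v vx p.1 p.2) 2 (slabMeasure 0 T) :=
  (S.memLp_slope_mul_velocity T).add (S.memLp_height_mul (memLp_of_cyl S.vx_L2 T))

lemma memLp_stress (S : IsWeakSolution σ ν h₀ v₀ h hx hxx v vx) (T : ℝ) :
    MemLp (fun p : ℝ × ℝ => stress σ ν h hx hxx v vx p.1 p.2) 2 (slabMeasure 0 T) :=
  (((S.memLp_height_mul (S.memLp_velocity_sq T)).sub
    ((S.memLp_height_mul (memLp_of_cyl S.hxx_L2 T)).const_mul σ)).add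
    ((S.memLp_slope_sq T).const_mul (σ / 2))).sub
    ((S.memLp_height_mul (memLp_of_cyl S.vx_L2 T)).const_mul ν)

lemma memLp_momentum (S : IsWeakSolution σ ν h₀ v₀ h hx hxx v vx) (T : ℝ) :
    MemLp (fun p : ℝ × ℝ => h p.1 p.2 * v p.1 p.2) 2 (slabMeasure 0 T) :=
  S.memLp_height_mul (memLp_of_cyl S.v_L2 T)

lemma slab_mono {a T : ℝ} (ha : 0 ≤ a) {F : ℝ × ℝ → ℝ} (hF : MemLp F 2 (slabMeasure 0 T)) :
    MemLp F 2 (slabMeasure a T) := by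
  refine hF.mono_measure ?_
  rw [slabMeasure_eq, slabMeasure_eq]
  exact Measure.restrict_mono (prod_mono_left (Ioc_subset_Ioc_left ha)) le_rfl

lemma isH1Zero_momentum (S : IsWeakSolution σ ν h₀ v₀ h hx hxx v vx) {t : ℝ} (ht : 0 ≤ t)
    (hr : Regular hx hxx v vx t) :
    IsH1Zero (fun x => h t x * v t x) (momentumDeriv h hx v vx t) :=
  (S.h_H1 t ht).mul_zero hr.2

lemma memLp_stress_slice (S : IsWeakSolution σ ν h₀ v₀ h hx hxx v vx) {t : ℝ} (ht : 0 ≤ t)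
    (hr : Regular hx hxx v vx t) : MemLp (stress σ ν h hx hxx v vx t) 2 unitMeasure := by
  have hc := S.height_continuousOn ht
  exact (((memLp_unit_of_continuousOn (hc.mul (hr.2.1.continuousOn.pow 2))).sub
    ((MemLp.continuousOn_mul hr.1.1.1 hc).const_mul σ)).add
    ((memLp_unit_of_continuousOn (hr.1.1.continuousOn.pow 2)).const_mul (σ / 2))).sub
    ((MemLp.continuousOn_mul hr.2.1.1 hc).const_mul ν)

/-- The mass balance, integrated in time. -/
lemma height_increment (S : IsWeakSolution σ ν h₀ v₀ h hx hxx v vx) {s t : ℝ} (hs : 0 ≤ s)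
    (hst : s ≤ t) :
    ∀ᵐ x ∂unitMeasure, h t x - h s x = -∫ r in s..t, momentumDeriv h hx v vx r x := by
  have ht := hs.trans hst
  have hmx := slab_mono hs (S.memLp_momentumDeriv t)
  have hms : ∀ τ, 0 ≤ τ → MemLp (h τ) 2 unitMeasure := fun τ hτ =>
    memLp_unit_of_continuousOn (S.height_continuousOn hτ)
  have hti := memLp_time_integral hst hmx
  have key : (fun x => h t x - h s x + ∫ r in s..t, momentumDeriv h hx v vx r x)
      =ᵐ[unitMeasure] 0 := by
    have hd : MemLp (fun x => h t x - h s x) 2 unitMeasure := (hms t ht).sub (hms s hs)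
    refine ae_eq_zero_of_test ((hd.add hti).integrable one_le_two) fun φ hφ => ?_
    have e1 := S.mass_eq φ hφ.1 t ht
    have e2 := S.mass_eq φ hφ.1 s hs
    simp only [integral_unit] at e1 e2
    have hi : ∀ T, 0 ≤ T → IntervalIntegrable (fun r => ∫ x, h r x * v r x * deriv φ x ∂unitMeasure)
        volume 0 T := fun T hT => intervalIntegrable_slab hT
      (f := fun p => h p.1 p.2 * v p.1 p.2 * deriv φ p.2)
      ((S.memLp_momentum T).integrable_mul (hφ.isH1Zero.1.1.comp_snd (volume.restrict (Ioc 0 T))))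
    have e3 := intervalIntegral.integral_interval_sub_left (hi t ht) (hi s hs)
    have e4 : ∫ r in s..t, ∫ x, h r x * v r x * deriv φ x ∂unitMeasure =
        -∫ r in s..t, ∫ x, momentumDeriv h hx v vx r x * φ x ∂unitMeasure := by
      rw [← intervalIntegral.integral_neg, intervalIntegral.integral_of_le hst,
        intervalIntegral.integral_of_le hst]
      refine integral_congr_ae ?_
      filter_upwards [S.ae_regular hs t, ae_nonneg_time hs t] with r hr hr0
      have := hφ.isH1Zero.1.integral_by_parts (S.isH1Zero_momentum hr0.2.2 hr)
      calc ∫ x, h r x * v r x * deriv φ x ∂unitMeasure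
          = ∫ x, deriv φ x * (h r x * v r x) ∂unitMeasure := by simp_rw [mul_comm]
        _ = _ := by rw [this]; simp_rw [mul_comm]
    rw [integral_time_integral_mul hst hmx hφ.memLp] at e4
    have i1 : Integrable (fun x => h t x * φ x) unitMeasure :=
      MemLp.integrable_mul' (hms t ht) hφ.memLp
    have i2 : Integrable (fun x => h s x * φ x) unitMeasure :=
      MemLp.integrable_mul' (hms s hs) hφ.memLp
    have i3 : Integrable (fun x => (∫ r in s..t, momentumDeriv h hx v vx r x) * φ x) unitMeasure :=
      MemLp.integrable_mul' hti hφ.memLp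
    have e5 : ∫ x, φ x * (h t x - h s x + ∫ r in s..t, momentumDeriv h hx v vx r x) ∂unitMeasure
        = (∫ x, h t x * φ x ∂unitMeasure) - (∫ x, h s x * φ x ∂unitMeasure) +
          ∫ x, (∫ r in s..t, momentumDeriv h hx v vx r x) * φ x ∂unitMeasure := by
      have i4 : Integrable (fun x => h t x * φ x - h s x * φ x) unitMeasure := i1.sub i2
      rw [← integral_sub i1 i2, ← integral_add i4 i3]
      refine integral_congr_ae (ae_of_all _ fun x => ?_)
      simp only
      ring
    rw [e5]
    linarith
  filter_upwards [key] with x hzero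
  have : h t x - h s x + ∫ r in s..t, momentumDeriv h hx v vx r x = 0 := hzero
  linarith

/-- The capillary force is a total derivative. -/
lemma integral_momentum_flux (S : IsWeakSolution σ ν h₀ v₀ h hx hxx v vx) {t : ℝ} (ht : 0 ≤ t)
    (hr : Regular hx hxx v vx t) {φ : ℝ → ℝ} (hφ : IsTest φ) :
    ∫ x, (h t x * v t x ^ 2 * deriv φ x
        - σ * (hxx t x * (hx t x * φ x + h t x * deriv φ x))
        - ν * (h t x * vx t x * deriv φ x)) ∂unitMeasure =
      ∫ x, stress σ ν h hx hxx v vx t x * deriv φ x ∂unitMeasure := by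
  -- The derivative of h_x² φ integrates to zero, which trades -σ h_xx h_x φ for (σ/2) h_x² φ'.
  have h1 := (hr.1.1.mul hr.1.1).mul_zero hφ.isH1Zero
  have h2 := h1.integral_deriv
  have i1 : Integrable (fun x => stress σ ν h hx hxx v vx t x * deriv φ x) unitMeasure :=
    MemLp.integrable_mul' (S.memLp_stress_slice ht hr) hφ.isH1Zero.1.1
  have i2 := (h1.1.1.integrable one_le_two).const_mul (σ / 2)
  have : ∫ x, (h t x * v t x ^ 2 * deriv φ x
        - σ * (hxx t x * (hx t x * φ x + h t x * deriv φ x))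
        - ν * (h t x * vx t x * deriv φ x)) ∂unitMeasure =
      (∫ x, stress σ ν h hx hxx v vx t x * deriv φ x ∂unitMeasure) -
      ∫ x, σ / 2 * ((hxx t x * hx t x + hx t x * hxx t x) * φ x + hx t x * hx t x * deriv φ x)
        ∂unitMeasure := by
    rw [← integral_sub i1 i2]
    refine integral_congr_ae (ae_of_all _ fun x => ?_)
    simp only [stress]
    ring
  rw [this, integral_const_mul, h2, mul_zero, sub_zero]

lemma memLp_momentum_slice (S : IsWeakSolution σ ν h₀ v₀ h hx hxx v vx) {t : ℝ} (ht : 0 ≤ t) :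
    MemLp (fun x => h t x * v t x) 2 unitMeasure :=
  MemLp.continuousOn_mul (S.v_mem t ht) (S.height_continuousOn ht)

lemma momentum_increment_test (S : IsWeakSolution σ ν h₀ v₀ h hx hxx v vx) {s t : ℝ} (hs : 0 ≤ s)
    (hst : s ≤ t) {φ : ℝ → ℝ} (hφ : IsTest φ) :
    ∫ x, (h t x * v t x - h s x * v s x) * φ x ∂unitMeasure =
      ∫ r in s..t, ∫ x, stress σ ν h hx hxx v vx r x * deriv φ x ∂unitMeasure := by
  have ht := hs.trans hst
  have e1 := S.momentum_eq φ hφ.1 hφ.2.2 t ht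
  have e2 := S.momentum_eq φ hφ.1 hφ.2.2 s hs
  simp only [integral_unit] at e1 e2
  have hcongr : ∀ T, 0 ≤ T → ∫ r in (0 : ℝ)..T, ∫ x, (h r x * v r x ^ 2 * deriv φ x
        - σ * (hxx r x * (hx r x * φ x + h r x * deriv φ x))
        - ν * (h r x * vx r x * deriv φ x)) ∂unitMeasure =
      ∫ r in (0 : ℝ)..T, ∫ x, stress σ ν h hx hxx v vx r x * deriv φ x ∂unitMeasure := by
    intro T hT
    rw [intervalIntegral.integral_of_le hT, intervalIntegral.integral_of_le hT]
    refine integral_congr_ae ?_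
    filter_upwards [S.ae_regular le_rfl T, ae_nonneg_time le_rfl T] with r hr hr0
    exact S.integral_momentum_flux hr0.2.2 hr hφ
  rw [hcongr t ht] at e1
  rw [hcongr s hs] at e2
  have hi : ∀ T, 0 ≤ T → IntervalIntegrable
      (fun r => ∫ x, stress σ ν h hx hxx v vx r x * deriv φ x ∂unitMeasure) volume 0 T :=
    fun T hT => intervalIntegrable_slab hT
      (f := fun p => stress σ ν h hx hxx v vx p.1 p.2 * deriv φ p.2)
      ((S.memLp_stress T).integrable_mul (hφ.isH1Zero.1.1.comp_snd (volume.restrict (Ioc 0 T))))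
  rw [← intervalIntegral.integral_interval_sub_left (hi t ht) (hi s hs), ← e1, ← e2]
  have i1 : Integrable (fun x => h t x * v t x * φ x) unitMeasure :=
    MemLp.integrable_mul' (S.memLp_momentum_slice ht) hφ.memLp
  have i2 : Integrable (fun x => h s x * v s x * φ x) unitMeasure :=
    MemLp.integrable_mul' (S.memLp_momentum_slice hs) hφ.memLp
  simp_rw [sub_mul]
  rw [integral_sub i1 i2]
  ring

/-- The momentum balance, integrated in time and tested with a function in `H¹₀`. -/
lemma momentum_increment (S : IsWeakSolution σ ν h₀ v₀ h hx hxx v vx) {s t : ℝ} (hs : 0 ≤ s)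
    (hst : s ≤ t) {w w' : ℝ → ℝ} (hw : IsH1Zero w w') :
    ∫ x, (h t x * v t x - h s x * v s x) * w x ∂unitMeasure =
      ∫ x, (∫ r in s..t, stress σ ν h hx hxx v vx r x) * w' x ∂unitMeasure := by
  have hP := slab_mono hs (S.memLp_stress t)
  refine integral_eq_of_test ((S.memLp_momentum_slice (hs.trans hst)).sub
    (S.memLp_momentum_slice hs)) (memLp_time_integral hst hP) (fun φ hφ => ?_) hw
  rw [← integral_time_integral_mul hst hP hφ.isH1Zero.1.1]
  exact S.momentum_increment_test hs hst hφ

end IsWeakSolution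

end

/-! ### Increments and rates of the kinetic, slope and cross energies -/

section

/-- Extension by zero outside the time interval `(0,T]`. -/
noncomputable def zeroExt (T : ℝ) (F : ℝ → ℝ → ℝ) : ℝ × ℝ → ℝ :=
  (Ioc 0 T ×ˢ univ).indicator fun p => F p.1 p.2

lemma zeroExt_of_mem {T : ℝ} {F : ℝ → ℝ → ℝ} {t : ℝ} (ht : t ∈ Ioc 0 T) (x : ℝ) :
    zeroExt T F (t, x) = F t x := by
  have : ((t, x) : ℝ × ℝ) ∈ (Ioc 0 T ×ˢ univ : Set (ℝ × ℝ)) := ⟨ht, mem_univ _⟩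
  simp [zeroExt, this]

lemma memLp_zeroExt {T : ℝ} {F : ℝ → ℝ → ℝ}
    (hF : MemLp (fun p : ℝ × ℝ => F p.1 p.2) 2 (slabMeasure 0 T)) :
    MemLp (zeroExt T F) 2 stripMeasure := by
  rw [slabMeasure_eq] at hF
  exact (memLp_indicator_iff_restrict (measurableSet_Ioc.prod MeasurableSet.univ)).2 hF

/-- Extension by zero clips the step [τ-δ, τ] at time 0, matching the clipped times `max (τ - δ) 0`
in the energy increments. -/
lemma integral_zeroExt {T : ℝ} (F : ℝ → ℝ → ℝ) {δ τ : ℝ} (hδ : 0 ≤ δ) (hτ : τ ∈ Ioc 0 T)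
    (x : ℝ) :
    ∫ r in (τ - δ)..τ, zeroExt T F (r, x) = ∫ r in (max (τ - δ) 0)..τ, F r x := by
  rw [intervalIntegral.integral_of_le (by linarith),
    intervalIntegral.integral_of_le (max_le (by linarith) hτ.1.le)]
  have h1 : (fun r => zeroExt T F (r, x)) = (Ioc 0 T).indicator fun r => F r x := by
    ext r
    by_cases hr : r ∈ Ioc 0 T
    · rw [zeroExt_of_mem hr, indicator_of_mem hr]
    · rw [indicator_of_notMem hr, zeroExt, indicator_of_notMem]
      exact fun h => hr h.1
  rw [h1, setIntegral_indicator measurableSet_Ioc, Ioc_inter_Ioc, min_eq_left hτ.2]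

lemma locallyIntegrable_max {X : ℝ → ℝ} (hX : ∀ T, IntegrableOn X (Ioc 0 T)) :
    LocallyIntegrable (fun τ => X (max τ 0)) volume := by
  intro x
  refine ⟨Ioc (-|x| - 1) (|x| + 1), Ioc_mem_nhds ?_ ?_, ?_⟩
  · linarith [neg_abs_le x]
  · linarith [le_abs_self x]
  have hsub : Ioc (-|x| - 1) (|x| + 1) ⊆ Ioc (-|x| - 1) 0 ∪ Ioc 0 (|x| + 1) := by
    intro y hy
    rcases le_or_gt y 0 with h | h
    · exact Or.inl ⟨hy.1, h⟩
    · exact Or.inr ⟨h, hy.2⟩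
  refine IntegrableOn.mono_set (IntegrableOn.union ?_ ?_) hsub
  · have : IntegrableOn (fun _ => X 0) (Ioc (-|x| - 1) 0) volume := integrableOn_const (by simp)
    exact this.congr_fun (fun y hy => by simp [max_eq_right hy.2]) measurableSet_Ioc
  · exact (hX (|x| + 1)).congr_fun (fun y hy => by simp [max_eq_left hy.1.le]) measurableSet_Ioc

/-- Upper bounds for the increments of `X` over short time steps in terms of Steklov averages
bound the total increment. -/
lemma increment_le {X : ℝ → ℝ} (hX : ∀ T, IntegrableOn X (Ioc 0 T)) {a b : ℝ} (ha : 0 ≤ a)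
    (hab : a ≤ b) (hla : LeftLebesguePoint (fun τ => X (max τ 0)) a)
    (hlb : LeftLebesguePoint (fun τ => X (max τ 0)) b) {F₁ W₁ F₂ W₂ : ℝ → ℝ → ℝ}
    (hF₁ : MemLp (fun p : ℝ × ℝ => F₁ p.1 p.2) 2 (slabMeasure 0 b))
    (hW₁ : MemLp (fun p : ℝ × ℝ => W₁ p.1 p.2) 2 (slabMeasure 0 b))
    (hF₂ : MemLp (fun p : ℝ × ℝ => F₂ p.1 p.2) 2 (slabMeasure 0 b))
    (hW₂ : MemLp (fun p : ℝ × ℝ => W₂ p.1 p.2) 2 (slabMeasure 0 b))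
    {κ : ℝ → ℝ} (hκ : Tendsto κ (𝓝[>] 0) (𝓝 0))
    (hstep : ∀ᶠ δ in 𝓝[>] (0 : ℝ), ∀ᵐ τ ∂(volume.restrict (Ioc a b)),
      X τ - X (max (τ - δ) 0) ≤
        (∫ x, (∫ r in (max (τ - δ) 0)..τ, F₁ r x) * W₁ τ x ∂unitMeasure) +
        ∫ x, (∫ r in (max (τ - δ) 0)..τ, F₂ r x) * zeroExt b W₂ (τ - κ δ, x) ∂unitMeasure) :
    X b - X a ≤ ∫ p, (F₁ p.1 p.2 * W₁ p.1 p.2 + F₂ p.1 p.2 * W₂ p.1 p.2) ∂slabMeasure a b := by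
  have mem : ∀ᵐ τ ∂(volume.restrict (Ioc a b)), τ ∈ Ioc 0 b := by
    filter_upwards [ae_restrict_mem measurableSet_Ioc] with τ hτ
    exact ⟨ha.trans_lt hτ.1, hτ.2⟩
  have mem' : ∀ᵐ p ∂slabMeasure a b, p.1 ∈ Ioc 0 b :=
    Measure.quasiMeasurePreserving_fst.ae mem
  have hF₁' := memLp_zeroExt hF₁
  have hW₁' := memLp_zeroExt hW₁
  have hF₂' := memLp_zeroExt hF₂
  have hW₂' := memLp_zeroExt hW₂
  have l1 := tendsto_steklov hF₁' hW₁' a b (κ := fun _ => 0) tendsto_const_nhds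
  have l2 := tendsto_steklov hF₂' hW₂' a b hκ
  have hlim := l1.add l2
  have i0 : ∀ {F W : ℝ × ℝ → ℝ}, MemLp F 2 stripMeasure → MemLp W 2 stripMeasure →
      Integrable (fun z => F z * W z) (slabMeasure a b) := fun hF hW =>
    (hF.mono_measure (slabMeasure_le a b)).integrable_mul (hW.mono_measure (slabMeasure_le a b))
  have eL : (∫ z, zeroExt b F₁ z * zeroExt b W₁ z ∂slabMeasure a b) +
      (∫ z, zeroExt b F₂ z * zeroExt b W₂ z ∂slabMeasure a b) =
      ∫ p, (F₁ p.1 p.2 * W₁ p.1 p.2 + F₂ p.1 p.2 * W₂ p.1 p.2) ∂slabMeasure a b := by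
    rw [← integral_add (i0 hF₁' hW₁') (i0 hF₂' hW₂')]
    refine integral_congr_ae ?_
    filter_upwards [mem'] with p hp
    have e : ∀ F, zeroExt b F p = F p.1 p.2 := fun F => zeroExt_of_mem hp p.2
    simp only [e]
  rw [eL] at hlim
  set R : ℝ → ℝ → ℝ := fun δ τ =>
    ∫ x, ((∫ r in (τ - δ)..τ, zeroExt b F₁ (r, x)) * zeroExt b W₁ (τ - 0, x) +
      (∫ r in (τ - δ)..τ, zeroExt b F₂ (r, x)) * zeroExt b W₂ (τ - κ δ, x)) ∂unitMeasure with hR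
  have hRi : ∀ δ, 0 < δ → Integrable (fun z : ℝ × ℝ =>
      (∫ r in (z.1 - δ)..z.1, zeroExt b F₁ (r, z.2)) * zeroExt b W₁ (z.1 - 0, z.2) +
      (∫ r in (z.1 - δ)..z.1, zeroExt b F₂ (r, z.2)) * zeroExt b W₂ (z.1 - κ δ, z.2))
      (slabMeasure a b) := fun δ hδ =>
    (steklov_integrable hF₁' hW₁' a b 0 hδ.le).add (steklov_integrable hF₂' hW₂' a b (κ δ) hδ.le)
  have key := sub_le_of_step (locallyIntegrable_max hX) hab hla hlb (R := R)
    (L := ∫ p, (F₁ p.1 p.2 * W₁ p.1 p.2 + F₂ p.1 p.2 * W₂ p.1 p.2) ∂slabMeasure a b) ?_ ?_ ?_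
  · simpa [max_eq_left ha, max_eq_left (ha.trans hab)] using key
  · filter_upwards [hstep, self_mem_nhdsWithin] with δ h1 (hδ : 0 < δ)
    have s1 := (steklov_integrable hF₁' hW₁' a b 0 hδ.le).prod_right_ae
    have s2 := (steklov_integrable hF₂' hW₂' a b (κ δ) hδ.le).prod_right_ae
    filter_upwards [h1, mem, s1, s2] with τ h2 h3 h4 h5
    rw [hR]
    simp only
    rw [integral_add h4 h5]
    simp only [integral_zeroExt _ hδ.le h3, sub_zero, zeroExt_of_mem h3]
    rw [max_eq_left h3.1.le]
    exact h2
  · filter_upwards [self_mem_nhdsWithin] with δ (hδ : 0 < δ)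
    exact (hRi δ hδ).integral_prod_left
  · refine hlim.congr' ?_
    filter_upwards [self_mem_nhdsWithin] with δ (hδ : 0 < δ)
    rw [← mul_add, ← integral_add (steklov_integrable hF₁' hW₁' a b 0 hδ.le)
      (steklov_integrable hF₂' hW₂' a b (κ δ) hδ.le), integral_prod _ (hRi δ hδ)]

/-- Twice the kinetic energy. -/
noncomputable def kinetic (h v : ℝ → ℝ → ℝ) (t : ℝ) : ℝ := ∫ x, h t x * v t x ^ 2 ∂unitMeasure

/-- The Dirichlet energy of the height (without the factor one half). -/
noncomputable def slopeEnergy (hx : ℝ → ℝ → ℝ) (t : ℝ) : ℝ := ∫ x, hx t x ^ 2 ∂unitMeasure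

/-- The product of momentum and slope. -/
noncomputable def crossEnergy (h hx v : ℝ → ℝ → ℝ) (t : ℝ) : ℝ :=
  ∫ x, h t x * v t x * hx t x ∂unitMeasure

namespace IsWeakSolution

variable {σ ν : ℝ} {h₀ v₀ : ℝ → ℝ} {h hx hxx v vx : ℝ → ℝ → ℝ}

lemma integrable_kinetic (S : IsWeakSolution σ ν h₀ v₀ h hx hxx v vx) {t : ℝ} (ht : 0 ≤ t) :
    Integrable (fun x => h t x * v t x ^ 2) unitMeasure :=
  Integrable.continuousOn_mul (S.v_mem t ht).integrable_sq (S.height_continuousOn ht)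

lemma integrableOn_kinetic (S : IsWeakSolution σ ν h₀ v₀ h hx hxx v vx) (T : ℝ) :
    IntegrableOn (kinetic h v) (Ioc 0 T) := by
  have h1 : Integrable (fun p : ℝ × ℝ => h p.1 p.2 * v p.1 p.2 * v p.1 p.2) (slabMeasure 0 T) :=
    (S.memLp_momentum T).integrable_mul (memLp_of_cyl S.v_L2 T)
  refine h1.integral_prod_left.congr (ae_of_all _ fun t => ?_)
  refine integral_congr_ae (ae_of_all _ fun x => ?_)
  simp only
  ring

lemma integrableOn_slopeEnergy (S : IsWeakSolution σ ν h₀ v₀ h hx hxx v vx) (T : ℝ) :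
    IntegrableOn (slopeEnergy hx) (Ioc 0 T) :=
  (memLp_of_cyl S.hx_L2 T).integrable_sq.integral_prod_left

lemma integrableOn_crossEnergy (S : IsWeakSolution σ ν h₀ v₀ h hx hxx v vx) (T : ℝ) :
    IntegrableOn (crossEnergy h hx v) (Ioc 0 T) := by
  have h1 : Integrable (fun p : ℝ × ℝ => h p.1 p.2 * v p.1 p.2 * hx p.1 p.2) (slabMeasure 0 T) :=
    (S.memLp_momentum T).integrable_mul (memLp_of_cyl S.hx_L2 T)
  exact h1.integral_prod_left

lemma memLp_height_slice (S : IsWeakSolution σ ν h₀ v₀ h hx hxx v vx) {t : ℝ} (ht : 0 ≤ t) :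
    MemLp (h t) 2 unitMeasure := memLp_unit_of_continuousOn (S.height_continuousOn ht)

/-- The increment of the height, tested with an `L²` function. -/
lemma integral_height_increment (S : IsWeakSolution σ ν h₀ v₀ h hx hxx v vx) {s t : ℝ}
    (hs : 0 ≤ s) (hst : s ≤ t) (w : ℝ → ℝ) :
    ∫ x, (h t x - h s x) * w x ∂unitMeasure =
      -∫ x, (∫ r in s..t, momentumDeriv h hx v vx r x) * w x ∂unitMeasure := by
  rw [← integral_neg]
  refine integral_congr_ae ?_
  filter_upwards [S.height_increment hs hst] with x hzero
  rw [hzero, neg_mul]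

/-- Pointwise, 2 (h_t v_t - h_s v_s) v_t - (h_t - h_s) v_t² exceeds h_t v_t² - h_s v_s² by h_s (v_t
- v_s)² ≥ 0, subscripts denoting times. Only the later velocity serves as a test function, so only
the time `t` must be regular. -/
lemma kinetic_step (S : IsWeakSolution σ ν h₀ v₀ h hx hxx v vx) {s t : ℝ} (hs : 0 ≤ s)
    (hst : s ≤ t) (hr : Regular hx hxx v vx t) :
    kinetic h v t - kinetic h v s ≤
      (∫ x, (∫ r in s..t, stress σ ν h hx hxx v vx r x) * (2 * vx t x) ∂unitMeasure) +
      ∫ x, (∫ r in s..t, momentumDeriv h hx v vx r x) * v t x ^ 2 ∂unitMeasure := by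
  have ht := hs.trans hst
  have e1 := S.momentum_increment hs hst hr.2
  have e2 := S.integral_height_increment hs hst (fun x => v t x ^ 2)
  have e3 : ∫ x, (∫ r in s..t, stress σ ν h hx hxx v vx r x) * (2 * vx t x) ∂unitMeasure =
      2 * ∫ x, (h t x * v t x - h s x * v s x) * v t x ∂unitMeasure := by
    rw [e1, ← integral_const_mul]
    refine integral_congr_ae (ae_of_all _ fun x => ?_)
    simp only
    ring
  have hvc := hr.2.1.continuousOn
  have i1 : Integrable (fun x => 2 * ((h t x * v t x - h s x * v s x) * v t x)) unitMeasure :=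
    (MemLp.integrable_mul' ((S.memLp_momentum_slice ht).sub (S.memLp_momentum_slice hs))
      (S.v_mem t ht)).const_mul 2
  have i2 : Integrable (fun x => (h t x - h s x) * v t x ^ 2) unitMeasure :=
    MemLp.integrable_mul' ((S.memLp_height_slice ht).sub (S.memLp_height_slice hs))
      (memLp_unit_of_continuousOn (hvc.pow 2))
  rw [e3, ← integral_const_mul, ← sub_neg_eq_add, ← e2, ← integral_sub i1 i2, kinetic, kinetic,
    ← integral_sub (S.integrable_kinetic ht) (S.integrable_kinetic hs)]
  refine integral_mono_ae ((S.integrable_kinetic ht).sub (S.integrable_kinetic hs)) (i1.sub i2) ?_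
  filter_upwards [ae_unit_mem_Icc] with x hxm
  have := mul_nonneg (S.h_nonneg s hs x hxm) (sq_nonneg (v t x - v s x))
  nlinarith

/-- Convexity, p² - q² ≤ 2 (p - q) p, then integration by parts onto h_xx(t) and the mass balance.
The factor 2 is written as two equal terms to fit the shape of `increment_le`. -/
lemma slopeEnergy_step (S : IsWeakSolution σ ν h₀ v₀ h hx hxx v vx) {s t : ℝ} (hs : 0 ≤ s)
    (hst : s ≤ t) (hr : Regular hx hxx v vx t) :
    slopeEnergy hx t - slopeEnergy hx s ≤
      (∫ x, (∫ r in s..t, momentumDeriv h hx v vx r x) * hxx t x ∂unitMeasure) +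
      ∫ x, (∫ r in s..t, momentumDeriv h hx v vx r x) * hxx t x ∂unitMeasure := by
  have ht := hs.trans hst
  have e1 := S.integral_height_increment hs hst (hxx t)
  have e2 := ((S.h_H1 t ht).sub (S.h_H1 s hs)).integral_by_parts hr.1
  have i1 := (S.h_H1 t ht).1.integrable_sq
  have i2 := (S.h_H1 s hs).1.integrable_sq
  have i3 : Integrable (fun x => 2 * ((hx t x - hx s x) * hx t x)) unitMeasure :=
    (MemLp.integrable_mul' ((S.h_H1 t ht).1.sub (S.h_H1 s hs).1) (S.h_H1 t ht).1).const_mul 2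
  have h1 : slopeEnergy hx t - slopeEnergy hx s ≤
      ∫ x, 2 * ((hx t x - hx s x) * hx t x) ∂unitMeasure := by
    rw [slopeEnergy, slopeEnergy, ← integral_sub i1 i2]
    refine integral_mono (i1.sub i2) i3 fun x => ?_
    simp only
    nlinarith [sq_nonneg (hx t x - hx s x)]
  rw [integral_const_mul] at h1
  linarith

/-- X is not convex, so the exact product rule is used: the momentum increment meets the later
slope, the slope increment meets the earlier momentum. The latter is integrated by parts, so time
`s` must be regular as well. -/
lemma crossEnergy_step (S : IsWeakSolution σ ν h₀ v₀ h hx hxx v vx) {s t : ℝ} (hs : 0 ≤ s)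
    (hst : s ≤ t) (hrs : Regular hx hxx v vx s) (hr : Regular hx hxx v vx t) :
    crossEnergy h hx v t - crossEnergy h hx v s =
      (∫ x, (∫ r in s..t, stress σ ν h hx hxx v vx r x) * hxx t x ∂unitMeasure) +
      ∫ x, (∫ r in s..t, momentumDeriv h hx v vx r x) * momentumDeriv h hx v vx s x
        ∂unitMeasure := by
  have ht := hs.trans hst
  have e1 := S.momentum_increment hs hst hr.1
  have e2 := S.integral_height_increment hs hst (momentumDeriv h hx v vx s)
  have e3 := ((S.h_H1 t ht).sub (S.h_H1 s hs)).integral_by_parts (S.isH1Zero_momentum hs hrs)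
  have it := (S.h_H1 t ht).1
  have is := (S.h_H1 s hs).1
  have mt := S.memLp_momentum_slice ht
  have ms := S.memLp_momentum_slice hs
  have i1 : Integrable (fun x => (h t x * v t x - h s x * v s x) * hx t x) unitMeasure :=
    MemLp.integrable_mul' (mt.sub ms) it
  have i2 : Integrable (fun x => (hx t x - hx s x) * (h s x * v s x)) unitMeasure :=
    MemLp.integrable_mul' (it.sub is) ms
  have i3 : Integrable (fun x => h t x * v t x * hx t x) unitMeasure := MemLp.integrable_mul' mt it
  have i4 : Integrable (fun x => h s x * v s x * hx s x) unitMeasure := MemLp.integrable_mul' ms is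
  have e4 : crossEnergy h hx v t - crossEnergy h hx v s =
      (∫ x, (h t x * v t x - h s x * v s x) * hx t x ∂unitMeasure) +
        ∫ x, (hx t x - hx s x) * (h s x * v s x) ∂unitMeasure := by
    rw [crossEnergy, crossEnergy, ← integral_sub i3 i4, ← integral_add i1 i2]
    refine integral_congr_ae (ae_of_all _ fun x => ?_)
    simp only
    ring
  rw [e4, e1]
  linarith

/-- The times that are Lebesgue points of all three energies. -/
def LebesgueTime (h hx v : ℝ → ℝ → ℝ) (t : ℝ) : Prop :=
  LeftLebesguePoint (fun τ => kinetic h v (max τ 0)) t ∧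
  LeftLebesguePoint (fun τ => slopeEnergy hx (max τ 0)) t ∧
  LeftLebesguePoint (fun τ => crossEnergy h hx v (max τ 0)) t

lemma ae_lebesgueTime (S : IsWeakSolution σ ν h₀ v₀ h hx hxx v vx) :
    ∀ᵐ t, LebesgueTime h hx v t := by
  filter_upwards [ae_leftLebesguePoint (locallyIntegrable_max S.integrableOn_kinetic),
    ae_leftLebesguePoint (locallyIntegrable_max S.integrableOn_slopeEnergy),
    ae_leftLebesguePoint (locallyIntegrable_max S.integrableOn_crossEnergy)] with t h1 h2 h3
  exact ⟨h1, h2, h3⟩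

lemma lebesgueTime_zero : LebesgueTime h hx v 0 :=
  ⟨leftLebesguePoint_of_const fun τ hτ => by simp [max_eq_right hτ],
    leftLebesguePoint_of_const fun τ hτ => by simp [max_eq_right hτ],
    leftLebesguePoint_of_const fun τ hτ => by simp [max_eq_right hτ]⟩

lemma kinetic_increment_le (S : IsWeakSolution σ ν h₀ v₀ h hx hxx v vx) {a b : ℝ} (ha : 0 ≤ a)
    (hab : a ≤ b) (hla : LebesgueTime h hx v a) (hlb : LebesgueTime h hx v b) :
    kinetic h v b - kinetic h v a ≤
      ∫ p, (stress σ ν h hx hxx v vx p.1 p.2 * (2 * vx p.1 p.2) +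
        momentumDeriv h hx v vx p.1 p.2 * v p.1 p.2 ^ 2) ∂slabMeasure a b := by
  refine increment_le S.integrableOn_kinetic ha hab hla.1 hlb.1
    (F₁ := stress σ ν h hx hxx v vx) (W₁ := fun t x => 2 * vx t x)
    (F₂ := momentumDeriv h hx v vx) (W₂ := fun t x => v t x ^ 2)
    (S.memLp_stress b) ((memLp_of_cyl S.vx_L2 b).const_mul 2) (S.memLp_momentumDeriv b)
    (S.memLp_velocity_sq b) (κ := fun _ => 0) tendsto_const_nhds ?_
  filter_upwards [self_mem_nhdsWithin] with δ (hδ : 0 < δ)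
  filter_upwards [S.ae_regular ha b, ae_restrict_mem measurableSet_Ioc] with τ hr hm
  have hτ : τ ∈ Ioc 0 b := ⟨ha.trans_lt hm.1, hm.2⟩
  simp only [sub_zero, zeroExt_of_mem hτ]
  exact S.kinetic_step (le_max_right _ _) (max_le (by linarith) hτ.1.le) hr

lemma slopeEnergy_increment_le (S : IsWeakSolution σ ν h₀ v₀ h hx hxx v vx) {a b : ℝ} (ha : 0 ≤ a)
    (hab : a ≤ b) (hla : LebesgueTime h hx v a) (hlb : LebesgueTime h hx v b) :
    slopeEnergy hx b - slopeEnergy hx a ≤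
      ∫ p, (momentumDeriv h hx v vx p.1 p.2 * hxx p.1 p.2 +
        momentumDeriv h hx v vx p.1 p.2 * hxx p.1 p.2) ∂slabMeasure a b := by
  refine increment_le S.integrableOn_slopeEnergy ha hab hla.2.1 hlb.2.1
    (S.memLp_momentumDeriv b) (memLp_of_cyl S.hxx_L2 b) (S.memLp_momentumDeriv b)
    (memLp_of_cyl S.hxx_L2 b) (κ := fun _ => 0) tendsto_const_nhds ?_
  filter_upwards [self_mem_nhdsWithin] with δ (hδ : 0 < δ)
  filter_upwards [S.ae_regular ha b, ae_restrict_mem measurableSet_Ioc] with τ hr hm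
  have hτ : τ ∈ Ioc 0 b := ⟨ha.trans_lt hm.1, hm.2⟩
  simp only [sub_zero, zeroExt_of_mem hτ]
  exact S.slopeEnergy_step (le_max_right _ _) (max_le (by linarith) hτ.1.le) hr

/-- The second pairing involves (h v)_x at the earlier time, hence the shift `κ δ = δ`. Starting at
`a > 0` keeps τ - δ positive for small δ, among the times that are almost all regular. -/
lemma crossEnergy_increment_le (S : IsWeakSolution σ ν h₀ v₀ h hx hxx v vx) {a b : ℝ} (ha : 0 < a)
    (hab : a ≤ b) (hla : LebesgueTime h hx v a) (hlb : LebesgueTime h hx v b) :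
    crossEnergy h hx v b - crossEnergy h hx v a ≤
      ∫ p, (stress σ ν h hx hxx v vx p.1 p.2 * hxx p.1 p.2 +
        momentumDeriv h hx v vx p.1 p.2 * momentumDeriv h hx v vx p.1 p.2) ∂slabMeasure a b := by
  refine increment_le S.integrableOn_crossEnergy ha.le hab hla.2.2 hlb.2.2
    (S.memLp_stress b) (memLp_of_cyl S.hxx_L2 b) (S.memLp_momentumDeriv b)
    (S.memLp_momentumDeriv b) (κ := fun δ => δ) (tendsto_id.mono_left nhdsWithin_le_nhds) ?_
  filter_upwards [self_mem_nhdsWithin, nhdsWithin_le_nhds (eventually_lt_nhds ha)]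
    with δ (hδ : 0 < δ) hδa
  have hshift : ∀ᵐ τ ∂(volume.restrict (Ioc a b)), Regular hx hxx v vx (τ - δ) := by
    have h1 := (ae_restrict_iff' measurableSet_Ioc).1 (S.ae_regular le_rfl b)
    have h2 := (measurePreserving_sub_right volume δ).quasiMeasurePreserving.ae h1
    filter_upwards [ae_restrict_of_ae h2, ae_restrict_mem measurableSet_Ioc] with τ h3 h4
    exact h3 ⟨by linarith [h4.1], by linarith [h4.2]⟩
  filter_upwards [S.ae_regular ha.le b, ae_restrict_mem measurableSet_Ioc, hshift] with τ hr hm hr'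
  have hτ : τ - δ ∈ Ioc 0 b := ⟨by linarith [hm.1], by linarith [hm.2]⟩
  simp only [zeroExt_of_mem hτ]
  rw [max_eq_left hτ.1.le]
  exact (S.crossEnergy_step hτ.1.le (by linarith) hr' hr).le

/-- The rate of change of the kinetic and capillary energies. -/
lemma energy_rate (S : IsWeakSolution σ ν h₀ v₀ h hx hxx v vx) {t : ℝ} (ht : 0 ≤ t)
    (hr : Regular hx hxx v vx t) :
    ∫ x, (stress σ ν h hx hxx v vx t x * (2 * vx t x) +
        momentumDeriv h hx v vx t x * v t x ^ 2 +
      σ * (momentumDeriv h hx v vx t x * hxx t x + momentumDeriv h hx v vx t x * hxx t x))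
        ∂unitMeasure =
      -(2 * ν) * ∫ x, h t x * vx t x ^ 2 ∂unitMeasure := by
  have H := S.h_H1 t ht
  -- The inertial terms add up to the derivative of h v³ and the capillary ones to σ times that of
  -- h_x² v; both integrate to zero.
  have z1 := (H.mul (hr.2.1.mul hr.2.1)).mul_zero hr.2
  have z2 := (hr.1.1.mul hr.1.1).mul_zero hr.2
  have i0 : Integrable (fun x => h t x * vx t x ^ 2) unitMeasure :=
    Integrable.continuousOn_mul hr.2.1.1.integrable_sq H.continuousOn
  have i1 := z1.1.1.integrable one_le_two
  have i2 := (z2.1.1.integrable one_le_two).const_mul σ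
  have e1 := z1.integral_deriv
  have e2 := z2.integral_deriv
  rw [← integral_const_mul]
  have i3 := i0.const_mul (-(2 * ν))
  have e3 := integral_add (i3.add i1) i2
  have e4 := integral_add i3 i1
  simp only [Pi.add_apply] at e3 e4
  rw [e4, e1, integral_const_mul σ, e2, mul_zero, add_zero, add_zero] at e3
  rw [← e3]
  refine integral_congr_ae (ae_of_all _ fun x => ?_)
  simp only [stress, momentumDeriv]
  ring

/-- The rate of change of the cross term. -/
lemma cross_rate (S : IsWeakSolution σ ν h₀ v₀ h hx hxx v vx) {t : ℝ} (ht : 0 ≤ t)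
    (hr : Regular hx hxx v vx t) :
    ∫ x, (stress σ ν h hx hxx v vx t x * hxx t x +
        momentumDeriv h hx v vx t x * momentumDeriv h hx v vx t x) ∂unitMeasure =
      ∫ x, (h t x ^ 2 * vx t x ^ 2 - σ * (h t x * hxx t x ^ 2) - ν * (h t x * vx t x * hxx t x))
        ∂unitMeasure := by
  have H := S.h_H1 t ht
  have hc := H.continuousOn
  -- The discarded exact derivatives are those of h v² h_x and of (σ/6) h_x³, which vanish at the
  -- ends because h_x does.
  have z1 := (H.mul (hr.2.1.mul hr.2.1)).mul_zero hr.1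
  have z2 := (hr.1.1.mul hr.1.1).mul_zero hr.1
  have i1 := z1.1.1.integrable one_le_two
  have i2 := (z2.1.1.integrable one_le_two).const_mul (σ / 6)
  have e1 := z1.integral_deriv
  have e2 := z2.integral_deriv
  have i3 : Integrable (fun x => h t x ^ 2 * vx t x ^ 2 - σ * (h t x * hxx t x ^ 2) -
      ν * (h t x * vx t x * hxx t x)) unitMeasure :=
    ((Integrable.continuousOn_mul hr.2.1.1.integrable_sq (hc.pow 2)).sub
      ((Integrable.continuousOn_mul hr.1.1.1.integrable_sq hc).const_mul σ)).sub
      ((MemLp.integrable_mul' (MemLp.continuousOn_mul hr.2.1.1 hc) hr.1.1.1).const_mul ν)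
  have e3 := integral_add (i3.add i1) i2
  have e4 := integral_add i3 i1
  simp only [Pi.add_apply] at e3 e4
  rw [e4, e1, integral_const_mul (σ / 6), e2, mul_zero, add_zero, add_zero] at e3
  rw [← e3]
  refine integral_congr_ae (ae_of_all _ fun x => ?_)
  simp only [stress, momentumDeriv]
  ring

end IsWeakSolution

end

/-! ### Coercivity of the dissipation and decay of the modified energy -/

section

section Coercivity

variable {f f' f'' : ℝ → ℝ} {M : ℝ}

/-- `f x - M` is the mean over y of `f x - f y`, and each of these is bounded by `IsH1.sq_sub_le'`.
-/
lemma IsH1.sq_sub_mean_le (hf : IsH1 f f') (hM : ∫ x, f x ∂unitMeasure = M) {x : ℝ}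
    (hx : x ∈ Icc (0 : ℝ) 1) : (f x - M) ^ 2 ≤ ∫ x, f' x ^ 2 ∂unitMeasure := by
  have hm : MemLp f 2 unitMeasure := memLp_unit_of_continuousOn hf.continuousOn
  have hd : MemLp (fun y => f x - f y) 2 unitMeasure := (memLp_const (f x)).sub hm
  have h1 : ∫ y, (f x - f y) ∂unitMeasure = f x - M := by
    rw [integral_sub (integrable_const _) (hm.integrable one_le_two), hM]
    simp
  have h2 := sq_integral_le hd
  rw [h1] at h2
  refine h2.trans ?_
  have h3 : ∫ y, (f x - f y) ^ 2 ∂unitMeasure ≤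
      ∫ _, (∫ x, f' x ^ 2 ∂unitMeasure) ∂unitMeasure := by
    refine integral_mono_ae hd.integrable_sq (integrable_const _) ?_
    filter_upwards [ae_unit_mem_Icc] with y hy using hf.sq_sub_le' hy hx
  simpa using h3

lemma IsH1.le_mean_add (hf : IsH1 f f') (hM : ∫ x, f x ∂unitMeasure = M) {q : ℝ}
    (hq : ∫ x, f' x ^ 2 ∂unitMeasure ≤ q) {x : ℝ} (hx : x ∈ Icc (0 : ℝ) 1) : f x ≤ M + √q := by
  have := Real.abs_le_sqrt ((hf.sq_sub_mean_le hM hx).trans hq)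
  linarith [le_abs_self (f x - M)]

lemma IsH1.half_mean_le (hf : IsH1 f f') (hM : ∫ x, f x ∂unitMeasure = M) (hM0 : 0 < M)
    (hq : ∫ x, f' x ^ 2 ∂unitMeasure ≤ M ^ 2 / 4) {x : ℝ} (hx : x ∈ Icc (0 : ℝ) 1) :
    M / 2 ≤ f x := by
  have h1 := (hf.sq_sub_mean_le hM hx).trans hq
  have h2 : |f x - M| ≤ M / 2 := abs_le_of_sq_le_sq (by nlinarith) (by positivity)
  linarith [(abs_le.1 h2).1]

/-- A non-flat profile has a definite amount of curvature, even where it vanishes. -/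
lemma weighted_curvature_ge (hf : IsH1 f f') (hf' : IsH1Zero f' f'')
    (hpos : ∀ x ∈ Icc (0 : ℝ) 1, 0 ≤ f x) (hM : ∫ x, f x ∂unitMeasure = M) (hM0 : 0 < M)
    (hq : M ^ 2 / 4 ≤ ∫ x, f' x ^ 2 ∂unitMeasure) :
    M ^ 3 / 16 ≤ ∫ x, f x * f'' x ^ 2 ∂unitMeasure := by
  have h1 := hf.integral_by_parts hf'
  have h2 : ∫ x, f' x ^ 2 ∂unitMeasure = -∫ x, f x * f'' x ∂unitMeasure := by
    rw [← h1]; simp_rw [sq]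
  have hm : Integrable f unitMeasure :=
    (memLp_unit_of_continuousOn hf.continuousOn (p := 2)).integrable one_le_two
  have i1 : Integrable (fun x => f x * f'' x ^ 2) unitMeasure :=
    Integrable.continuousOn_mul hf'.1.1.integrable_sq hf.continuousOn
  have i2 : Integrable (fun x => f x * f'' x) unitMeasure :=
    Integrable.continuousOn_mul (hf'.1.1.integrable one_le_two) hf.continuousOn
  -- Young's inequality keeping the weight `f` on both sides. The coefficient M/8 makes the last
  -- term integrate to M²/8, half of the lower bound for ∫ f'² = -∫ f f''.
  have h3 : ∫ x, -(f x * f'' x) ∂unitMeasure ≤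
      ∫ x, (2 / M * (f x * f'' x ^ 2) + M / 8 * f x) ∂unitMeasure := by
    refine integral_mono_ae i2.neg ((i1.const_mul _).add (hm.const_mul _)) ?_
    filter_upwards [ae_unit_mem_Icc] with x hx
    have e : 2 / M * (f x * f'' x ^ 2) + M / 8 * f x + f x * f'' x =
        f x * (2 / M) * (f'' x + M / 4) ^ 2 := by
      field_simp; ring
    have : 0 ≤ f x * (2 / M) * (f'' x + M / 4) ^ 2 := by
      have := hpos x hx
      positivity
    linarith
  rw [integral_neg, ← h2, integral_add (i1.const_mul _) (hm.const_mul _), integral_const_mul,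
    integral_const_mul, hM] at h3
  have h4 : M ^ 2 / 8 ≤ 2 / M * ∫ x, f x * f'' x ^ 2 ∂unitMeasure := by nlinarith
  have h5 : M / 2 * (M ^ 2 / 8) ≤ M / 2 * (2 / M * ∫ x, f x * f'' x ^ 2 ∂unitMeasure) := by gcongr
  have h6 : M / 2 * (2 / M * ∫ x, f x * f'' x ^ 2 ∂unitMeasure) =
      ∫ x, f x * f'' x ^ 2 ∂unitMeasure := by field_simp
  rw [h6] at h5
  linarith

lemma le_weighted_integral {g w : ℝ → ℝ} {c : ℝ} (hw : ContinuousOn w (Icc 0 1))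
    (hg : MemLp g 2 unitMeasure) (hc : ∀ x ∈ Icc (0 : ℝ) 1, c ≤ w x) :
    c * ∫ x, g x ^ 2 ∂unitMeasure ≤ ∫ x, w x * g x ^ 2 ∂unitMeasure := by
  rw [← integral_const_mul]
  refine integral_mono_ae (hg.integrable_sq.const_mul _)
    (Integrable.continuousOn_mul hg.integrable_sq hw) ?_
  filter_upwards [ae_unit_mem_Icc] with x hx
  exact mul_le_mul_of_nonneg_right (hc x hx) (sq_nonneg _)

lemma weighted_integral_le {g w : ℝ → ℝ} {c : ℝ} (hw : ContinuousOn w (Icc 0 1))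
    (hg : MemLp g 2 unitMeasure) (hc : ∀ x ∈ Icc (0 : ℝ) 1, w x ≤ c) :
    ∫ x, w x * g x ^ 2 ∂unitMeasure ≤ c * ∫ x, g x ^ 2 ∂unitMeasure := by
  rw [← integral_const_mul]
  refine integral_mono_ae (Integrable.continuousOn_mul hg.integrable_sq hw)
    (hg.integrable_sq.const_mul _) ?_
  filter_upwards [ae_unit_mem_Icc] with x hx
  exact mul_le_mul_of_nonneg_right (hc x hx) (sq_nonneg _)

/-- The dissipation controls the energy. -/
lemma coercivity {u u' : ℝ → ℝ} (hf : IsH1 f f') (hf' : IsH1Zero f' f'') (hu : IsH1Zero u u')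
    (hpos : ∀ x ∈ Icc (0 : ℝ) 1, 0 ≤ f x) (hM : ∫ x, f x ∂unitMeasure = M) (hM0 : 0 < M)
    {K N σ a c B : ℝ} (hK : ∀ x ∈ Icc (0 : ℝ) 1, f x ≤ K)
    (ha : 0 ≤ a) (hc : 0 ≤ c)
    (hN : (∫ x, f x * u x ^ 2 ∂unitMeasure) + σ * ∫ x, f' x ^ 2 ∂unitMeasure ≤ N)
    (hB : 0 ≤ B) (hB1 : B * (2 * K) ≤ a * M) (hB2 : B * (2 * σ) ≤ c * M)
    (hB3 : B * N ≤ c * (M ^ 3 / 16)) :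
    B * ((∫ x, f x * u x ^ 2 ∂unitMeasure) + σ * ∫ x, f' x ^ 2 ∂unitMeasure) ≤
      a * (∫ x, f x * u' x ^ 2 ∂unitMeasure) + c * ∫ x, f x * f'' x ^ 2 ∂unitMeasure := by
  have hS : 0 ≤ ∫ x, f x * u' x ^ 2 ∂unitMeasure := integral_nonneg_of_ae <| by
    filter_upwards [ae_unit_mem_Icc] with x hx using mul_nonneg (hpos x hx) (sq_nonneg _)
  -- Either the profile is so flat that f ≥ M/2 and unweighted Poincaré inequalities apply, or its
  -- weighted curvature is at least M³/16, enough to dominate B times the energy bound N.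
  rcases le_or_gt (∫ x, f' x ^ 2 ∂unitMeasure) (M ^ 2 / 4) with h | h
  · have hl : ∀ x ∈ Icc (0 : ℝ) 1, M / 2 ≤ f x := fun x hx => hf.half_mean_le hM hM0 h hx
    have hu2 : MemLp u 2 unitMeasure := memLp_unit_of_continuousOn hu.1.continuousOn
    have h1 := weighted_integral_le hf.continuousOn hu2 hK
    have h2 := hu.integral_sq_le
    have h3 := le_weighted_integral hf.continuousOn hu.1.1 hl
    have h4 := hf'.integral_sq_le
    have h5 := le_weighted_integral hf.continuousOn hf'.1.1 hl
    set k := ∫ x, f x * u x ^ 2 ∂unitMeasure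
    set p := ∫ x, f' x ^ 2 ∂unitMeasure
    set Su := ∫ x, f x * u' x ^ 2 ∂unitMeasure
    set D := ∫ x, f x * f'' x ^ 2 ∂unitMeasure
    set p2 := ∫ x, f'' x ^ 2 ∂unitMeasure
    set U := ∫ x, u x ^ 2 ∂unitMeasure
    set U' := ∫ x, u' x ^ 2 ∂unitMeasure
    have hU0 : 0 ≤ U := integral_nonneg fun x => sq_nonneg _
    have hp0 : 0 ≤ p := integral_nonneg fun x => sq_nonneg _
    have e1 : B * k ≤ a * Su := by
      calc B * k ≤ B * (K * U) := by gcongr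
        _ = B * (2 * K) * (U / 2) := by ring
        _ ≤ a * M * (U / 2) := by gcongr
        _ = a * (M / 2 * U) := by ring
        _ ≤ a * (M / 2 * U') := by gcongr
        _ ≤ a * Su := by gcongr
    have e2 : B * (σ * p) ≤ c * D := by
      calc B * (σ * p) = B * (2 * σ) * (p / 2) := by ring
        _ ≤ c * M * (p / 2) := by gcongr
        _ = c * (M / 2 * p) := by ring
        _ ≤ c * (M / 2 * p2) := by gcongr
        _ ≤ c * D := by gcongr
    linarith
  · have h1 := weighted_curvature_ge hf hf' hpos hM hM0 h.le
    calc _ ≤ B * N := by gcongr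
      _ ≤ c * (M ^ 3 / 16) := hB3
      _ ≤ c * ∫ x, f x * f'' x ^ 2 ∂unitMeasure := by gcongr
      _ ≤ _ := by nlinarith

/-- A weighted `L²` bound follows by duality from testing with smooth functions. -/
lemma weighted_sq_le_of_test {f w : ℝ → ℝ} {α : ℝ} (hf : MemLp f 2 unitMeasure)
    (hw : ContinuousOn w (Icc 0 1))
    (h : ∀ φ, IsTest φ → 2 * ∫ x, w x * f x * φ x ∂unitMeasure ≤
      α + ∫ x, w x * φ x ^ 2 ∂unitMeasure) :
    ∫ x, w x * f x ^ 2 ∂unitMeasure ≤ α := by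
  obtain ⟨K, hK⟩ := isCompact_Icc.exists_bound_of_continuousOn hw
  have hK' : ∀ x ∈ Icc (0 : ℝ) 1, w x ≤ |K| + 1 := fun x hx =>
    (le_abs_self _).trans ((hK x hx).trans ((le_abs_self K).trans (by linarith)))
  refine le_of_forall_pos_le_add fun ε hε => ?_
  have hK0 : 0 < |K| + 1 := by positivity
  obtain ⟨φ, hφ, hd⟩ := exists_test_integral_sq_sub_le hf (div_pos hε hK0)
  have hφm : MemLp φ 2 unitMeasure := hφ.memLp
  have h1 := h φ hφ
  have h2 := weighted_integral_le hw (hf.sub hφm) hK'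
  have i1 : Integrable (fun x => w x * f x ^ 2) unitMeasure :=
    Integrable.continuousOn_mul hf.integrable_sq hw
  have i2 : Integrable (fun x => w x * φ x ^ 2) unitMeasure :=
    Integrable.continuousOn_mul hφm.integrable_sq hw
  have i3 : Integrable (fun x => 2 * (w x * f x * φ x)) unitMeasure :=
    (MemLp.integrable_mul' (MemLp.continuousOn_mul hf hw) hφm).const_mul 2
  have i4 : Integrable (fun x => w x * f x ^ 2 - 2 * (w x * f x * φ x)) unitMeasure := i1.sub i3
  -- Completing the square: the loss in the dual formula is the weighted distance from `f` to `φ`,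
  -- at most ε by the choice of `φ`.
  have e : ∫ x, w x * (f - φ) x ^ 2 ∂unitMeasure = (∫ x, w x * f x ^ 2 ∂unitMeasure) -
      2 * (∫ x, w x * f x * φ x ∂unitMeasure) + ∫ x, w x * φ x ^ 2 ∂unitMeasure := by
    rw [← integral_const_mul, ← integral_sub i1 i3, ← integral_add i4 i2]
    refine integral_congr_ae (ae_of_all _ fun x => ?_)
    simp only [Pi.sub_apply]
    ring
  rw [e] at h2
  have h3 : (|K| + 1) * ∫ x, (f - φ) x ^ 2 ∂unitMeasure ≤ ε := by
    calc _ ≤ (|K| + 1) * (ε / (|K| + 1)) := by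
          gcongr
          exact hd
      _ = ε := by field_simp
  linarith

end Coercivity

/-- Geometric decay of a functional that is dissipated at a proportional rate. -/
lemma geometric_decay {Φ : ℝ → ℝ} {G : ℝ → Prop} {B C : ℝ} (hB : 0 ≤ B) (hG : ∀ᵐ t, G t)
    (hint : ∀ T, IntegrableOn Φ (Ioc 0 T)) (hpos : ∀ t, 0 < t → G t → 0 ≤ Φ t)
    (hC : ∀ t, 0 < t → G t → Φ t ≤ C)
    (hd : ∀ a b, 0 < a → a ≤ b → G a → G b → Φ b + B * ∫ τ in Ioc a b, Φ τ ≤ Φ a) (k : ℕ) :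
    ∀ t : ℝ, k < t → G t → Φ t ≤ C * ((1 + B)⁻¹) ^ k := by
  induction k with
  | zero => intro t ht hGt; simpa using hC t (by simpa using ht) hGt
  | succ k ih =>
    intro t ht hGt
    push_cast at ht
    have hk : (0 : ℝ) ≤ k := Nat.cast_nonneg k
    -- A good time at which the induction hypothesis applies and which precedes `t` by more than one
    -- unit.
    obtain ⟨s, hs, hGs⟩ : ∃ s ∈ Ioo (k : ℝ) (t - 1), G s := by
      have h1 : ∃ᵐ s ∂(volume.restrict (Ioo (k : ℝ) (t - 1))), True := by
        rw [frequently_true_iff_neBot, ae_neBot, Ne, Measure.restrict_eq_zero]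
        simp [ht]
      obtain ⟨s, _, h2, h3⟩ := (h1.and_eventually
        ((ae_restrict_mem measurableSet_Ioo).and (ae_restrict_of_ae hG))).exists
      exact ⟨s, h2, h3⟩
    have hs0 : 0 < s := hk.trans_lt hs.1
    have h1 := hd s t hs0 (by linarith [hs.2]) hGs hGt
    have hsub : Ioc s t ⊆ Ioc 0 t := Ioc_subset_Ioc_left hs0.le
    -- Φ is nonincreasing along good times. As t - s > 1, the integral is at least Φ t, which gives
    -- (1 + B) Φ t ≤ Φ s.
    have hmono : ∫ _ in Ioc s t, Φ t ≤ ∫ τ in Ioc s t, Φ τ := by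
      refine integral_mono_ae (by simp) ((hint t).mono_set hsub) ?_
      filter_upwards [ae_restrict_mem measurableSet_Ioc, ae_restrict_of_ae hG] with r hr hGr
      have hr0 := hs0.trans hr.1
      have h2 := hd r t hr0 hr.2 hGr hGt
      have h3 : 0 ≤ ∫ τ in Ioc r t, Φ τ := by
        refine integral_nonneg_of_ae ?_
        filter_upwards [ae_restrict_mem measurableSet_Ioc, ae_restrict_of_ae hG] with q hq hGq
        exact hpos q (hr0.trans hq.1) hGq
      nlinarith
    have h4 : ∫ _ in Ioc s t, Φ t = (t - s) * Φ t := by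
      simp [show s ≤ t by linarith [hs.2]]
    have h5 := ih s hs.1 hGs
    have h6 := hpos t (by linarith) hGt
    have h7 : (1 + B) * Φ t ≤ Φ s := by
      have : Φ t ≤ (t - s) * Φ t := by nlinarith [hs.2]
      rw [h4] at hmono
      nlinarith
    rw [pow_succ, ← mul_assoc, ← div_eq_mul_inv, le_div_iff₀ (by positivity)]
    linarith

namespace IsWeakSolution

variable {σ ν : ℝ} {h₀ v₀ : ℝ → ℝ} {h hx hxx v vx : ℝ → ℝ → ℝ}

lemma integral_height (S : IsWeakSolution σ ν h₀ v₀ h hx hxx v vx) {t : ℝ} (ht : 0 ≤ t) :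
    ∫ x, h t x ∂unitMeasure = ∫ x, h₀ x ∂unitMeasure := by
  have := S.mass_eq (fun _ => 1) contDiff_const t ht
  simp only [integral_unit, mul_one, deriv_const, mul_zero,
    intervalIntegral.integral_zero] at this
  linarith

lemma kinetic_nonneg (S : IsWeakSolution σ ν h₀ v₀ h hx hxx v vx) {t : ℝ} (ht : 0 ≤ t) :
    0 ≤ kinetic h v t := integral_nonneg_of_ae <| by
  filter_upwards [ae_unit_mem_Icc] with x hx
  exact mul_nonneg (S.h_nonneg t ht x hx) (sq_nonneg _)

lemma slopeEnergy_nonneg (hx : ℝ → ℝ → ℝ) (t : ℝ) : 0 ≤ slopeEnergy hx t :=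
  integral_nonneg fun _ => sq_nonneg _

lemma integrable_energy_density (S : IsWeakSolution σ ν h₀ v₀ h hx hxx v vx) {a : ℝ} (ha : 0 ≤ a)
    (b : ℝ) :
    Integrable (fun p : ℝ × ℝ => stress σ ν h hx hxx v vx p.1 p.2 * (2 * vx p.1 p.2) +
        momentumDeriv h hx v vx p.1 p.2 * v p.1 p.2 ^ 2) (slabMeasure a b) ∧
    Integrable (fun p : ℝ × ℝ => momentumDeriv h hx v vx p.1 p.2 * hxx p.1 p.2 +
        momentumDeriv h hx v vx p.1 p.2 * hxx p.1 p.2) (slabMeasure a b) ∧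
    Integrable (fun p : ℝ × ℝ => stress σ ν h hx hxx v vx p.1 p.2 * hxx p.1 p.2 +
        momentumDeriv h hx v vx p.1 p.2 * momentumDeriv h hx v vx p.1 p.2) (slabMeasure a b) ∧
    Integrable (fun p : ℝ × ℝ => stress σ ν h hx hxx v vx p.1 p.2 * (2 * vx p.1 p.2) +
        momentumDeriv h hx v vx p.1 p.2 * v p.1 p.2 ^ 2 +
      σ * (momentumDeriv h hx v vx p.1 p.2 * hxx p.1 p.2 +
        momentumDeriv h hx v vx p.1 p.2 * hxx p.1 p.2)) (slabMeasure a b) := by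
  have m1 := slab_mono ha (S.memLp_stress b)
  have m2 := slab_mono ha (S.memLp_momentumDeriv b)
  have m3 := slab_mono ha (memLp_of_cyl S.vx_L2 b)
  have m4 := slab_mono ha (memLp_of_cyl S.hxx_L2 b)
  have m5 := slab_mono ha (S.memLp_velocity_sq b)
  have i1 := (m1.integrable_mul (m3.const_mul 2)).add (m2.integrable_mul m5)
  have i2 := (m2.integrable_mul m4).add (m2.integrable_mul m4)
  exact ⟨i1, i2, (m1.integrable_mul m4).add (m2.integrable_mul m2), i1.add (i2.const_mul σ)⟩

/-- The energy at Lebesgue times does not exceed the initial energy. -/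
lemma energy_le (S : IsWeakSolution σ ν h₀ v₀ h hx hxx v vx) (hσ : 0 ≤ σ) (hν : 0 ≤ ν) {b : ℝ}
    (hb : 0 ≤ b) (hlb : LebesgueTime h hx v b) :
    kinetic h v b + σ * slopeEnergy hx b ≤ kinetic h v 0 + σ * slopeEnergy hx 0 := by
  have h1 := S.kinetic_increment_le le_rfl hb lebesgueTime_zero hlb
  have h2 := mul_le_mul_of_nonneg_left
    (S.slopeEnergy_increment_le le_rfl hb lebesgueTime_zero hlb) hσ
  obtain ⟨i1, i2, -, i12⟩ := S.integrable_energy_density le_rfl b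
  have e := integral_add i1 (i2.const_mul σ)
  rw [integral_const_mul, integral_prod _ i12] at e
  have h3 : ∫ t, (∫ x, (stress σ ν h hx hxx v vx t x * (2 * vx t x) +
        momentumDeriv h hx v vx t x * v t x ^ 2 +
      σ * (momentumDeriv h hx v vx t x * hxx t x + momentumDeriv h hx v vx t x * hxx t x))
        ∂unitMeasure) ∂(volume.restrict (Ioc 0 b)) ≤ 0 := by
    refine integral_nonpos_of_ae ?_
    filter_upwards [S.ae_regular le_rfl b, ae_nonneg_time le_rfl b] with t hr ht
    rw [S.energy_rate ht.2.2 hr]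
    have : 0 ≤ ∫ x, h t x * vx t x ^ 2 ∂unitMeasure := integral_nonneg_of_ae <| by
      filter_upwards [ae_unit_mem_Icc] with x hx
      exact mul_nonneg (S.h_nonneg t ht.2.2 x hx) (sq_nonneg _)
    simp only [Pi.zero_apply]
    nlinarith
  linarith

/-- The modified energy is dissipated at least at a rate bounding its own rate of change. -/
lemma modifiedEnergy_increment (S : IsWeakSolution σ ν h₀ v₀ h hx hxx v vx) (hσ : 0 ≤ σ)
    {ε B : ℝ} (hε : 0 ≤ ε) {a b : ℝ} (ha : 0 < a) (hab : a ≤ b) (hla : LebesgueTime h hx v a)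
    (hlb : LebesgueTime h hx v b)
    (hrate : ∀ᵐ t ∂(volume.restrict (Ioc a b)),
      -ν * (∫ x, h t x * vx t x ^ 2 ∂unitMeasure) +
        ε * (∫ x, (h t x ^ 2 * vx t x ^ 2 - σ * (h t x * hxx t x ^ 2) -
          ν * (h t x * vx t x * hxx t x)) ∂unitMeasure) ≤
      -B * ((kinetic h v t + σ * slopeEnergy hx t) / 2 + ε * crossEnergy h hx v t)) :
    ((kinetic h v b + σ * slopeEnergy hx b) / 2 + ε * crossEnergy h hx v b) +
      B * (∫ t in Ioc a b,
        ((kinetic h v t + σ * slopeEnergy hx t) / 2 + ε * crossEnergy h hx v t)) ≤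
      (kinetic h v a + σ * slopeEnergy hx a) / 2 + ε * crossEnergy h hx v a := by
  have h1 := S.kinetic_increment_le ha.le hab hla hlb
  have h2 := mul_le_mul_of_nonneg_left (S.slopeEnergy_increment_le ha.le hab hla hlb) hσ
  have h3 := mul_le_mul_of_nonneg_left (S.crossEnergy_increment_le ha hab hla hlb) hε
  obtain ⟨i1, i2, i3, i12⟩ := S.integrable_energy_density ha.le b
  have e := integral_add i1 (i2.const_mul σ)
  rw [integral_const_mul, integral_prod _ i12] at e
  rw [integral_prod _ i3] at h3
  have j1 := i12.integral_prod_left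
  have j2 := i3.integral_prod_left
  have e2 := integral_add (j1.const_mul (1 / 2)) (j2.const_mul ε)
  rw [integral_const_mul, integral_const_mul] at e2
  have hsub : Ioc a b ⊆ Ioc 0 b := Ioc_subset_Ioc_left ha.le
  have k1 : IntegrableOn (fun t => (kinetic h v t + σ * slopeEnergy hx t) / 2 +
      ε * crossEnergy h hx v t) (Ioc a b) :=
    IntegrableOn.mono_set ((((S.integrableOn_kinetic b).add
      ((S.integrableOn_slopeEnergy b).const_mul σ)).div_const 2).add
      ((S.integrableOn_crossEnergy b).const_mul ε)) hsub
  have h4 := integral_mono_ae ((j1.const_mul (1 / 2)).add (j2.const_mul ε))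
    (k1.integrable.const_mul (-B)) ?_
  · rw [integral_const_mul] at h4
    simp only [Pi.add_apply] at h4 e2 e
    linarith
  · filter_upwards [S.ae_regular ha.le b, ae_nonneg_time ha.le b, hrate] with t hr ht hle
    have r1 := S.energy_rate ht.2.2 hr
    have r2 := S.cross_rate ht.2.2 hr
    simp only [Pi.add_apply]
    rw [r1, r2]
    linarith

end IsWeakSolution

end

/-! ### Semicontinuity in time and exponential decay at every time -/

section

lemma frequently_nhdsGT_of_ae {G : ℝ → Prop} (hG : ∀ᵐ t, G t) (t : ℝ) : ∃ᶠ τ in 𝓝[>] t, G τ := by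
  intro hnot
  obtain ⟨u, hu, hsub⟩ := (mem_nhdsGT_iff_exists_Ioo_subset).1 hnot
  have h1 : volume (Ioo t u) = 0 := measure_mono_null hsub (by simpa using ae_iff.1 hG)
  simp only [Real.volume_Ioo, ENNReal.ofReal_eq_zero, tsub_le_iff_right, zero_add] at h1
  exact absurd h1 (not_le.2 hu)

lemma tendsto_primitive_nhdsGT {g : ℝ → ℝ} (hg : ∀ T, 0 ≤ T → IntervalIntegrable g volume 0 T)
    {t : ℝ} (ht : 0 ≤ t) :
    Tendsto (fun τ => ∫ r in (0 : ℝ)..τ, g r) (𝓝[>] t) (𝓝 (∫ r in (0 : ℝ)..t, g r)) := by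
  have h0 : (0 : ℝ) ≤ t + 1 := by linarith
  have h1 := intervalIntegral.continuousOn_primitive_interval (a := 0) (b := t + 1)
    (by
      rw [uIcc_of_le h0]
      exact (intervalIntegrable_iff_integrableOn_Icc_of_le h0).1 (hg (t + 1) h0))
  rw [uIcc_of_le h0] at h1
  have h2 := (h1 t ⟨ht, by linarith⟩).tendsto
  refine h2.mono_left (nhdsWithin_le_of_mem ?_)
  filter_upwards [Ioo_mem_nhdsGT (show t < t + 1 by linarith)] with τ hτ
  exact ⟨ht.trans hτ.1.le, hτ.2.le⟩

namespace IsWeakSolution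

variable {σ ν : ℝ} {h₀ v₀ : ℝ → ℝ} {h hx hxx v vx : ℝ → ℝ → ℝ}

/-- The weak equation writes the tested height as a constant plus the primitive of an integrable
function. This and its analogue for the momentum are the only continuity in time used below. -/
lemma tendsto_integral_height_mul (S : IsWeakSolution σ ν h₀ v₀ h hx hxx v vx) {t : ℝ}
    (ht : 0 ≤ t) {φ : ℝ → ℝ} (hφ : ContDiff ℝ ∞ φ) :
    Tendsto (fun τ => ∫ x, h τ x * φ x ∂unitMeasure) (𝓝[>] t)
      (𝓝 (∫ x, h t x * φ x ∂unitMeasure)) := by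
  have hi : ∀ T, 0 ≤ T → IntervalIntegrable (fun r => ∫ x, h r x * v r x * deriv φ x ∂unitMeasure)
      volume 0 T := fun T hT => intervalIntegrable_slab hT
    (f := fun p => h p.1 p.2 * v p.1 p.2 * deriv φ p.2)
    ((S.memLp_momentum T).integrable_mul
      ((IsH1.of_contDiff hφ).1.comp_snd (volume.restrict (Ioc 0 T))))
  have e : ∀ τ, 0 ≤ τ → ∫ x, h τ x * φ x ∂unitMeasure = (∫ x, h₀ x * φ x ∂unitMeasure) +
      ∫ r in (0 : ℝ)..τ, ∫ x, h r x * v r x * deriv φ x ∂unitMeasure := by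
    intro τ hτ
    have := S.mass_eq φ hφ τ hτ
    simp only [integral_unit] at this
    linarith
  rw [e t ht]
  refine ((tendsto_primitive_nhdsGT hi ht).const_add _).congr' ?_
  filter_upwards [self_mem_nhdsWithin] with τ (hτ : t < τ)
  exact (e τ (ht.trans hτ.le)).symm

lemma tendsto_integral_momentum_mul (S : IsWeakSolution σ ν h₀ v₀ h hx hxx v vx) {t : ℝ}
    (ht : 0 ≤ t) {φ : ℝ → ℝ} (hφ : IsTest φ) :
    Tendsto (fun τ => ∫ x, h τ x * v τ x * φ x ∂unitMeasure) (𝓝[>] t)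
      (𝓝 (∫ x, h t x * v t x * φ x ∂unitMeasure)) := by
  have hi : ∀ T, 0 ≤ T → IntervalIntegrable
      (fun r => ∫ x, stress σ ν h hx hxx v vx r x * deriv φ x ∂unitMeasure) volume 0 T :=
    fun T hT => intervalIntegrable_slab hT
      (f := fun p => stress σ ν h hx hxx v vx p.1 p.2 * deriv φ p.2)
      ((S.memLp_stress T).integrable_mul (hφ.isH1Zero.1.1.comp_snd (volume.restrict (Ioc 0 T))))
  have hm : ∀ τ, 0 ≤ τ → Integrable (fun x => h τ x * v τ x * φ x) unitMeasure := fun τ hτ =>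
    MemLp.integrable_mul' (S.memLp_momentum_slice hτ) hφ.memLp
  have e : ∀ τ, 0 ≤ τ → ∫ x, h τ x * v τ x * φ x ∂unitMeasure =
      (∫ x, h 0 x * v 0 x * φ x ∂unitMeasure) +
      ∫ r in (0 : ℝ)..τ, ∫ x, stress σ ν h hx hxx v vx r x * deriv φ x ∂unitMeasure := by
    intro τ hτ
    have := S.momentum_increment_test le_rfl hτ hφ
    simp_rw [sub_mul] at this
    rw [integral_sub (hm τ hτ) (hm 0 le_rfl)] at this
    linarith
  rw [e t ht]
  refine ((tendsto_primitive_nhdsGT hi ht).const_add _).congr' ?_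
  filter_upwards [self_mem_nhdsWithin] with τ (hτ : t < τ)
  exact (e τ (ht.trans hτ.le)).symm

/-- The kinetic energy is lower semicontinuous in time. -/
lemma kinetic_le_of_ae (S : IsWeakSolution σ ν h₀ v₀ h hx hxx v vx) {α : ℝ → ℝ} {t : ℝ}
    (ht : 0 ≤ t) (hα : ContinuousAt α t) (hle : ∀ᵐ τ, 0 < τ → kinetic h v τ ≤ α τ) :
    kinetic h v t ≤ α t := by
  -- The kinetic energy is the supremum over test functions of 2 ∫ h v φ - ∫ h φ², and each such
  -- expression is right-continuous at `t`, so a bound at almost every later time passes to `t`.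
  refine weighted_sq_le_of_test (S.v_mem t ht) (S.height_continuousOn ht) fun φ hφ => ?_
  have l1 := (S.tendsto_integral_momentum_mul ht hφ).const_mul 2
  have l2 := (hα.tendsto.mono_left nhdsWithin_le_nhds).add
    (S.tendsto_integral_height_mul ht (hφ.1.pow 2))
  have l3 := l2.sub l1
  have hf : ∃ᶠ τ in 𝓝[>] t, 0 ≤ (α τ + ∫ x, h τ x * φ x ^ 2 ∂unitMeasure) -
      2 * ∫ x, h τ x * v τ x * φ x ∂unitMeasure := by
    refine ((frequently_nhdsGT_of_ae hle t).and_eventually self_mem_nhdsWithin).mono ?_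
    rintro τ ⟨h1, h2 : t < τ⟩
    have hτ : 0 ≤ τ := ht.trans h2.le
    have hc := S.height_continuousOn hτ
    have i1 := S.integrable_kinetic hτ
    have i2 : Integrable (fun x => h τ x * φ x ^ 2) unitMeasure :=
      Integrable.continuousOn_mul (MemLp.integrable_sq_unit hφ.memLp) hc
    have i3 : Integrable (fun x => 2 * (h τ x * v τ x * φ x)) unitMeasure :=
      (MemLp.integrable_mul' (S.memLp_momentum_slice hτ) hφ.memLp).const_mul 2
    have h3 : 2 * ∫ x, h τ x * v τ x * φ x ∂unitMeasure ≤
        kinetic h v τ + ∫ x, h τ x * φ x ^ 2 ∂unitMeasure := by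
      rw [kinetic, ← integral_const_mul, ← integral_add i1 i2]
      refine integral_mono_ae i3 (i1.add i2) ?_
      filter_upwards [ae_unit_mem_Icc] with x hx
      have := mul_nonneg (S.h_nonneg τ hτ x hx) (sq_nonneg (v τ x - φ x))
      nlinarith
    linarith [h1 (ht.trans_lt h2)]
  have := ge_of_tendsto_of_frequently l3 hf
  linarith

/-- The slope energy is lower semicontinuous in time. -/
lemma slopeEnergy_le_of_ae (S : IsWeakSolution σ ν h₀ v₀ h hx hxx v vx) {α : ℝ → ℝ} {t : ℝ}
    (ht : 0 ≤ t) (hα : ContinuousAt α t) (hle : ∀ᵐ τ, 0 < τ → slopeEnergy hx τ ≤ α τ) :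
    slopeEnergy hx t ≤ α t := by
  have key : ∫ x, (1 : ℝ) * hx t x ^ 2 ∂unitMeasure ≤ α t := by
    refine weighted_sq_le_of_test (w := fun _ => 1) (S.h_H1 t ht).1 continuousOn_const
      fun φ hφ => ?_
    simp only [one_mul]
    have hder : ContDiff ℝ ∞ (deriv φ) := (contDiff_infty_iff_deriv.1 hφ.1).2
    -- Moving the derivative onto φ reduces weak right-continuity of the slope to that of the
    -- height.
    have hibp : ∀ τ, 0 ≤ τ → ∫ x, hx τ x * φ x ∂unitMeasure =
        -∫ x, h τ x * deriv φ x ∂unitMeasure := fun τ hτ =>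
      (S.h_H1 τ hτ).integral_by_parts hφ.isH1Zero
    have l1 := ((S.tendsto_integral_height_mul ht hder).neg).const_mul 2
    have l2 := (hα.tendsto.mono_left (nhdsWithin_le_nhds (s := Ioi t))).add_const (∫ x, φ x ^ 2 ∂unitMeasure)
    have l3 := l2.sub l1
    have hf : ∃ᶠ τ in 𝓝[>] t, 0 ≤ (α τ + ∫ x, φ x ^ 2 ∂unitMeasure) -
        2 * -∫ x, h τ x * deriv φ x ∂unitMeasure := by
      refine ((frequently_nhdsGT_of_ae hle t).and_eventually self_mem_nhdsWithin).mono ?_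
      rintro τ ⟨h1, h2 : t < τ⟩
      have hτ : 0 ≤ τ := ht.trans h2.le
      have i1 := (S.h_H1 τ hτ).1.integrable_sq
      have i2 : Integrable (fun x => φ x ^ 2) unitMeasure := MemLp.integrable_sq_unit hφ.memLp
      have i3 : Integrable (fun x => 2 * (hx τ x * φ x)) unitMeasure :=
        (MemLp.integrable_mul' (S.h_H1 τ hτ).1 hφ.memLp).const_mul 2
      rw [← hibp τ hτ]
      have h3 : 2 * ∫ x, hx τ x * φ x ∂unitMeasure ≤
          slopeEnergy hx τ + ∫ x, φ x ^ 2 ∂unitMeasure := by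
        rw [slopeEnergy, ← integral_const_mul, ← integral_add i1 i2]
        refine integral_mono i3 (i1.add i2) fun x => ?_
        simp only
        nlinarith [sq_nonneg (hx τ x - φ x)]
      linarith [h1 (ht.trans_lt h2)]
    have := ge_of_tendsto_of_frequently l3 hf
    rw [hibp t ht]
    linarith
  simpa [slopeEnergy] using key

lemma abs_crossEnergy_le (S : IsWeakSolution σ ν h₀ v₀ h hx hxx v vx) {t K : ℝ} (ht : 0 ≤ t)
    (hK : ∀ x ∈ Icc (0 : ℝ) 1, h t x ≤ K) :
    |crossEnergy h hx v t| ≤ (kinetic h v t + K * slopeEnergy hx t) / 2 := by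
  have i1 := S.integrable_kinetic ht
  have i2 := (S.h_H1 t ht).1.integrable_sq.const_mul K
  have e : (kinetic h v t + K * slopeEnergy hx t) / 2 =
      ∫ x, (h t x * v t x ^ 2 + K * hx t x ^ 2) / 2 ∂unitMeasure := by
    rw [integral_div, integral_add i1 i2, integral_const_mul, kinetic, slopeEnergy]
  rw [e, crossEnergy, ← Real.norm_eq_abs]
  refine norm_integral_le_of_norm_le ((i1.add i2).div_const 2) ?_
  filter_upwards [ae_unit_mem_Icc] with x hxm
  have h0 := S.h_nonneg t ht x hxm
  have h1 := mul_le_mul_of_nonneg_right (hK x hxm) (sq_nonneg (hx t x))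
  rw [Real.norm_eq_abs, abs_le]
  constructor
  · nlinarith [mul_nonneg h0 (sq_nonneg (v t x + hx t x))]
  · nlinarith [mul_nonneg h0 (sq_nonneg (v t x - hx t x))]

/-- The mixed term is absorbed by the square h (σ/2) ((ν/σ) v_x + h_xx)² ≥ 0, which costs half of
the capillary dissipation; h² ≤ K h handles the first term. -/
lemma cross_rate_le (S : IsWeakSolution σ ν h₀ v₀ h hx hxx v vx) (hσ : 0 < σ) {t K : ℝ}
    (ht : 0 ≤ t) (hr : Regular hx hxx v vx t) (hK : ∀ x ∈ Icc (0 : ℝ) 1, h t x ≤ K) :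
    ∫ x, (h t x ^ 2 * vx t x ^ 2 - σ * (h t x * hxx t x ^ 2) -
        ν * (h t x * vx t x * hxx t x)) ∂unitMeasure ≤
      (K + ν ^ 2 / (2 * σ)) * (∫ x, h t x * vx t x ^ 2 ∂unitMeasure) -
        σ / 2 * ∫ x, h t x * hxx t x ^ 2 ∂unitMeasure := by
  have hc := S.height_continuousOn ht
  have i1 : Integrable (fun x => h t x * vx t x ^ 2) unitMeasure :=
    Integrable.continuousOn_mul hr.2.1.1.integrable_sq hc
  have i2 : Integrable (fun x => h t x * hxx t x ^ 2) unitMeasure :=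
    Integrable.continuousOn_mul hr.1.1.1.integrable_sq hc
  have i3 : Integrable (fun x => h t x ^ 2 * vx t x ^ 2 - σ * (h t x * hxx t x ^ 2) -
      ν * (h t x * vx t x * hxx t x)) unitMeasure :=
    ((Integrable.continuousOn_mul hr.2.1.1.integrable_sq (hc.pow 2)).sub (i2.const_mul σ)).sub
      ((MemLp.integrable_mul' (MemLp.continuousOn_mul hr.2.1.1 hc) hr.1.1.1).const_mul ν)
  rw [← integral_const_mul, ← integral_const_mul,
    ← integral_sub (i1.const_mul _) (i2.const_mul _)]
  refine integral_mono_ae i3 ((i1.const_mul _).sub (i2.const_mul _)) ?_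
  filter_upwards [ae_unit_mem_Icc] with x hx
  have h0 := S.h_nonneg t ht x hx
  have h1 : h t x ^ 2 * vx t x ^ 2 ≤ K * (h t x * vx t x ^ 2) := by
    have := mul_le_mul_of_nonneg_right (hK x hx) (mul_nonneg h0 (sq_nonneg (vx t x)))
    nlinarith
  have h2 : 0 ≤ h t x * (σ / 2) * (ν / σ * vx t x + hxx t x) ^ 2 := by positivity
  have h3 : h t x * (σ / 2) * (ν / σ * vx t x + hxx t x) ^ 2 =
      ν ^ 2 / (2 * σ) * (h t x * vx t x ^ 2) + ν * (h t x * vx t x * hxx t x) +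
        σ / 2 * (h t x * hxx t x ^ 2) := by
    field_simp
    ring
  linarith

/-- Exponential decay of the energy, with constants depending only on the parameters, the mass
and a bound of the initial energy. -/
lemma exists_energy_decay (hσ : 0 < σ) (hν : 0 < ν) {M N : ℝ} (hM : 0 < M) (hN : 0 < N) :
    ∃ A β : ℝ, 0 < A ∧ 0 < β ∧ ∀ (h₀ v₀ : ℝ → ℝ) (h hx hxx v vx : ℝ → ℝ → ℝ),
      IsWeakSolution σ ν h₀ v₀ h hx hxx v vx → ∫ x, h₀ x ∂unitMeasure = M →
      kinetic h v 0 + σ * slopeEnergy hx 0 ≤ N → ∀ t, 0 ≤ t →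
      kinetic h v t ≤ A * Real.exp (-β * t) ∧ slopeEnergy hx t ≤ A * Real.exp (-β * t) := by
  -- A bound for h wherever the energy is at most N, since then ∫ h_x² ≤ N/σ.
  set K := M + √(N / σ) with hKdef
  have hK : 0 < K := by positivity
  -- The first two entries give ε |X| ≤ E/4; the third leaves half of the viscous dissipation after
  -- the viscous part of the cross rate is absorbed.
  set ε := min (1 / 2) (min (σ / (2 * K)) (ν / (2 * (K + ν ^ 2 / (2 * σ))))) with hεdef
  have hε : 0 < ε := by positivity
  have hε1 : ε ≤ 1 / 2 := min_le_left _ _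
  have hε2 : ε * (2 * K) ≤ σ :=
    (le_div_iff₀ (by positivity)).1 ((min_le_right _ _).trans (min_le_left _ _))
  have hε3 : ε * (2 * (K + ν ^ 2 / (2 * σ))) ≤ ν :=
    (le_div_iff₀ (by positivity)).1 ((min_le_right _ _).trans (min_le_right _ _))
  set c := ε * σ / 2 with hcdef
  have hc : 0 < c := by positivity
  -- The entries are the three smallness conditions of `coercivity` with `a = ν / 2` and `c = ε σ /
  -- 2`.
  set B := min (ν / 2 * M / (2 * K)) (min (c * M / (2 * σ)) (c * (M ^ 3 / 16) / N)) with hBdef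
  have hB : 0 < B := by positivity
  have hB1 : B * (2 * K) ≤ ν / 2 * M := (le_div_iff₀ (by positivity)).1 (min_le_left _ _)
  have hB2 : B * (2 * σ) ≤ c * M :=
    (le_div_iff₀ (by positivity)).1 ((min_le_right _ _).trans (min_le_left _ _))
  have hB3 : B * N ≤ c * (M ^ 3 / 16) :=
    (le_div_iff₀ (by positivity)).1 ((min_le_right _ _).trans (min_le_right _ _))
  -- The contraction factor (1 + B)⁻¹ per unit of time equals e^{-β}. Below, the 4 in `A` comes from
  -- E ≤ 4 Φ and e^β from rounding the time down to an integer.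
  set β := Real.log (1 + B) with hβdef
  have hβ : 0 < β := Real.log_pos (by linarith)
  set A := 4 * N * Real.exp β with hAdef
  have hA : 0 < A := by positivity
  refine ⟨A + A / σ, β, by positivity, hβ, ?_⟩
  intro h₀ v₀ h hx hxx v vx S hmass hinit
  set Φ : ℝ → ℝ := fun t => (kinetic h v t + σ * slopeEnergy hx t) / 2 + ε * crossEnergy h hx v t
    with hΦ
  have hmean : ∀ t, 0 ≤ t → ∫ x, h t x ∂unitMeasure = M := fun t ht =>
    (S.integral_height ht).trans hmass
  have hE : ∀ t, 0 < t → LebesgueTime h hx v t →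
      kinetic h v t + σ * slopeEnergy hx t ≤ N := fun t ht hl =>
    (S.energy_le hσ.le hν.le ht.le hl).trans hinit
  have hle : ∀ t, 0 < t → LebesgueTime h hx v t → ∀ x ∈ Icc (0 : ℝ) 1, h t x ≤ K := by
    intro t ht hl x hxm
    refine (S.h_H1 t ht.le).le_mean_add (hmean t ht.le) ?_ hxm
    rw [le_div_iff₀ hσ]
    have := hE t ht hl
    have := S.kinetic_nonneg ht.le
    change slopeEnergy hx t * σ ≤ N
    linarith
  have hcross : ∀ t, 0 < t → LebesgueTime h hx v t →
      (kinetic h v t + σ * slopeEnergy hx t) / 4 ≤ Φ t ∧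
      Φ t ≤ kinetic h v t + σ * slopeEnergy hx t := by
    intro t ht hl
    have h1 := S.abs_crossEnergy_le ht.le (hle t ht hl)
    have hk := S.kinetic_nonneg ht.le
    have hp := slopeEnergy_nonneg hx t
    have h2 : ε * |crossEnergy h hx v t| ≤ (kinetic h v t + σ * slopeEnergy hx t) / 4 := by
      calc ε * |crossEnergy h hx v t|
          ≤ ε * ((kinetic h v t + K * slopeEnergy hx t) / 2) := by gcongr
        _ = ε * kinetic h v t / 2 + ε * (2 * K) * slopeEnergy hx t / 4 := by ring
        _ ≤ 1 / 2 * kinetic h v t / 2 + σ * slopeEnergy hx t / 4 := by gcongr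
        _ = _ := by ring
    have h3 : |ε * crossEnergy h hx v t| ≤ (kinetic h v t + σ * slopeEnergy hx t) / 4 := by
      rwa [abs_mul, abs_of_pos hε]
    have h4 := abs_le.1 h3
    have hp' : 0 ≤ σ * slopeEnergy hx t := by positivity
    simp only [hΦ]
    constructor <;> linarith [h4.1, h4.2]
  have hpos : ∀ t, 0 < t → LebesgueTime h hx v t → 0 ≤ Φ t := by
    intro t ht hl
    have hk := S.kinetic_nonneg ht.le
    have hp := mul_nonneg hσ.le (slopeEnergy_nonneg hx t)
    linarith [(hcross t ht hl).1]
  have hdiss : ∀ a b, 0 < a → a ≤ b → LebesgueTime h hx v a → LebesgueTime h hx v b →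
      Φ b + B * ∫ τ in Ioc a b, Φ τ ≤ Φ a := by
    intro a b ha hab hla hlb
    refine S.modifiedEnergy_increment hσ.le hε.le ha hab hla hlb ?_
    filter_upwards [S.ae_regular ha.le b, ae_nonneg_time ha.le b,
      ae_restrict_of_ae S.ae_lebesgueTime] with t hr ht hl
    have ht0 : 0 < t := ha.trans ht.1
    have h1 := S.cross_rate_le hσ ht0.le hr (hle t ht0 hl)
    have h2 := coercivity (S.h_H1 t ht0.le) hr.1 hr.2 (S.h_nonneg t ht0.le) (hmean t ht0.le) hM
      (hle t ht0 hl) (by positivity : (0 : ℝ) ≤ ν / 2) hc.le (hE t ht0 hl) hB.le hB1 hB2 hB3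
    have h3 := (hcross t ht0 hl).2
    have hS : 0 ≤ ∫ x, h t x * vx t x ^ 2 ∂unitMeasure := integral_nonneg_of_ae <| by
      filter_upwards [ae_unit_mem_Icc] with x hxm
      exact mul_nonneg (S.h_nonneg t ht0.le x hxm) (sq_nonneg _)
    have h4 := mul_le_mul_of_nonneg_left h1 hε.le
    have h5 := mul_le_mul_of_nonneg_right hε3 hS
    have h6 := mul_le_mul_of_nonneg_left h3 hB.le
    change _ ≤ -B * Φ t
    change B * (kinetic h v t + σ * slopeEnergy hx t) ≤ _ at h2
    rw [hcdef] at h2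
    nlinarith
  have hdecay := geometric_decay hB.le S.ae_lebesgueTime (fun T =>
    (((S.integrableOn_kinetic T).add
      ((S.integrableOn_slopeEnergy T).const_mul σ)).div_const 2).add
      ((S.integrableOn_crossEnergy T).const_mul ε)) hpos
    (fun t ht hl => (hcross t ht hl).2.trans (hE t ht hl)) hdiss
  have hae : ∀ t, 0 < t → LebesgueTime h hx v t →
      kinetic h v t + σ * slopeEnergy hx t ≤ A * Real.exp (-β * t) := by
    intro t ht hl
    -- `geometric_decay` needs `k < t` strictly, hence ⌈t⌉ - 1 rather than the floor.
    obtain ⟨k, hk⟩ : ∃ k : ℕ, (k : ℝ) < t ∧ t ≤ k + 1 := by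
      refine ⟨⌈t⌉₊ - 1, ?_, ?_⟩
      · have h1 : 0 < ⌈t⌉₊ := Nat.ceil_pos.2 ht
        rw [Nat.cast_sub h1]
        have := Nat.ceil_lt_add_one ht.le
        push_cast
        linarith
      · have h1 : 0 < ⌈t⌉₊ := Nat.ceil_pos.2 ht
        rw [Nat.cast_sub h1]
        have := Nat.le_ceil t
        push_cast
        linarith
    have h1 : Φ t ≤ N * ((1 + B)⁻¹) ^ k := hdecay k t hk.1 hl
    have h2 := (hcross t ht hl).1
    have h3 : ((1 + B)⁻¹) ^ k ≤ Real.exp β * Real.exp (-β * t) := by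
      have e : (1 + B)⁻¹ = Real.exp (-β) := by
        rw [Real.exp_neg, hβdef, Real.exp_log (by positivity)]
      rw [e, ← Real.exp_nat_mul, ← Real.exp_add]
      refine Real.exp_le_exp.2 ?_
      nlinarith [hk.2]
    have h4 : N * ((1 + B)⁻¹) ^ k ≤ N * (Real.exp β * Real.exp (-β * t)) := by gcongr
    rw [hAdef]
    linarith
  have hcont : ∀ C : ℝ, Continuous fun t => C * Real.exp (-β * t) := fun C => by fun_prop
  intro t ht
  have hexp := Real.exp_pos (-β * t)
  constructor
  · have h1 := S.kinetic_le_of_ae ht (hcont A).continuousAt (by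
      filter_upwards [S.ae_lebesgueTime] with τ hl hτ
      have := mul_nonneg hσ.le (slopeEnergy_nonneg hx τ)
      linarith [hae τ hτ hl])
    have h2 : 0 ≤ A / σ * Real.exp (-β * t) := by positivity
    linarith
  · have h1 := S.slopeEnergy_le_of_ae ht (hcont (A / σ)).continuousAt (by
      filter_upwards [S.ae_lebesgueTime] with τ hl hτ
      have h3 := S.kinetic_nonneg hτ.le
      have h4 := hae τ hτ hl
      rw [div_mul_eq_mul_div, le_div_iff₀ hσ]
      linarith)
    have h2 : 0 ≤ A * Real.exp (-β * t) := by positivity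
    linarith

end IsWeakSolution

end

/-! ### Norm estimates and conclusion -/

section Norms

variable {f g : ℝ → ℝ}

lemma eLpNorm_two_eq (hf : MemLp f 2 unitMeasure) :
    eLpNorm f 2 unitMeasure = ENNReal.ofReal (√(∫ x, f x ^ 2 ∂unitMeasure)) := by
  rw [hf.eLpNorm_eq_integral_rpow_norm (by simp) (by simp)]
  simp [Real.sqrt_eq_rpow]

lemma eLpNorm_two_le (hf : MemLp f 2 unitMeasure) {q : ℝ} (hq : ∫ x, f x ^ 2 ∂unitMeasure ≤ q) :
    eLpNorm f 2 unitMeasure ≤ ENNReal.ofReal (√q) := by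
  rw [eLpNorm_two_eq hf]
  exact ENNReal.ofReal_le_ofReal (Real.sqrt_le_sqrt hq)

lemma IsH1.h1Norm_le {M q : ℝ} (hf : IsH1 f g) (hM : ∫ x, f x ∂unitMeasure = M)
    (hq : ∫ x, g x ^ 2 ∂unitMeasure ≤ q) :
    h1Norm (fun x => f x - M) g ≤ (2 * ENNReal.ofReal (√q) ^ 2) ^ (1 / 2 : ℝ) := by
  have hm : MemLp (fun x => f x - M) 2 unitMeasure :=
    memLp_unit_of_continuousOn (hf.continuousOn.sub continuousOn_const)
  have h1 : ∫ x, (f x - M) ^ 2 ∂unitMeasure ≤ ∫ _, q ∂unitMeasure := by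
    refine integral_mono_ae hm.integrable_sq (integrable_const _) ?_
    filter_upwards [ae_unit_mem_Icc] with x hx using (hf.sq_sub_mean_le hM hx).trans hq
  have h2 := eLpNorm_two_le hm (q := q) (by simpa using h1)
  have h3 := eLpNorm_two_le hf.1 hq
  rw [h1Norm, two_mul]
  gcongr

lemma IsH1.holderHalfNorm_le {M q : ℝ} (hf : IsH1 f g) (hM : ∫ x, f x ∂unitMeasure = M)
    (hq : ∫ x, g x ^ 2 ∂unitMeasure ≤ q) :
    holderHalfNorm (fun x => f x - M) ≤ ENNReal.ofReal (√q) + ENNReal.ofReal (√q) := by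
  rw [holderHalfNorm]
  refine add_le_add (iSup₂_le fun x hx => ?_) (iSup₂_le fun x hx => iSup₂_le fun y hy => ?_)
  · rw [← ofReal_norm, Real.norm_eq_abs]
    exact ENNReal.ofReal_le_ofReal (Real.abs_le_sqrt ((hf.sq_sub_mean_le hM hx).trans hq))
  · refine ENNReal.div_le_of_le_mul ?_
    rw [← ofReal_norm, ← ofReal_norm, Real.norm_eq_abs, Real.norm_eq_abs,
      ENNReal.ofReal_rpow_of_nonneg (abs_nonneg _) (by norm_num), ← Real.sqrt_eq_rpow,
      ← ENNReal.ofReal_mul (Real.sqrt_nonneg _)]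
    refine ENNReal.ofReal_le_ofReal ?_
    have hq0 : 0 ≤ q := (integral_nonneg fun x => sq_nonneg _).trans hq
    rw [mul_comm, ← Real.sqrt_mul (abs_nonneg _)]
    refine Real.abs_le_sqrt ?_
    have h1 := hf.sq_sub_le hy hx
    have h2 : f x - M - (f y - M) = f x - f y := by ring
    rw [h2]
    exact h1.trans (by gcongr)

end Norms

namespace IsWeakSolution

variable {σ ν : ℝ} {h₀ v₀ : ℝ → ℝ} {h hx hxx v vx : ℝ → ℝ → ℝ}

lemma kinetic_zero (S : IsWeakSolution σ ν h₀ v₀ h hx hxx v vx) :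
    kinetic h v 0 = ∫ x, h₀ x * v₀ x ^ 2 ∂unitMeasure := by
  refine integral_congr_ae ?_
  filter_upwards [ae_unit_mem_Icc, S.v_init] with x h1 h2
  rw [S.h_init x h1, h2]

lemma slopeEnergy_zero (S : IsWeakSolution σ ν h₀ v₀ h hx hxx v vx) {h₀' : ℝ → ℝ}
    (hH1 : IsH1 h₀ h₀') : slopeEnergy hx 0 = ∫ x, h₀' x ^ 2 ∂unitMeasure := by
  refine integral_congr_ae ?_
  filter_upwards [(S.h_H1 0 le_rfl).ae_eq hH1 S.h_init] with x h1
  rw [h1]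

/-- The integrand is h³ v² = h² · h v², and h² ≤ K². -/
lemma integral_weighted_velocity_le (S : IsWeakSolution σ ν h₀ v₀ h hx hxx v vx) {t K : ℝ}
    (ht : 0 ≤ t) (hK : ∀ x ∈ Icc (0 : ℝ) 1, h t x ≤ K) :
    ∫ x, (h t x ^ (3 / 2 : ℝ) * v t x) ^ 2 ∂unitMeasure ≤ K ^ 2 * kinetic h v t := by
  rw [kinetic, ← integral_const_mul]
  refine integral_mono_of_nonneg (ae_of_all _ fun x => sq_nonneg _)
    ((S.integrable_kinetic ht).const_mul _) ?_
  filter_upwards [ae_unit_mem_Icc] with x hxm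
  have h0 := S.h_nonneg t ht x hxm
  have e : (h t x ^ (3 / 2 : ℝ)) ^ 2 = h t x ^ 3 := by
    rw [← Real.rpow_natCast, ← Real.rpow_mul h0, ← Real.rpow_natCast]
    norm_num
  rw [mul_pow, e]
  have h1 : h t x ^ 2 ≤ K ^ 2 := pow_le_pow_left₀ h0 (hK x hxm) 2
  calc h t x ^ 3 * v t x ^ 2 = h t x ^ 2 * (h t x * v t x ^ 2) := by ring
    _ ≤ K ^ 2 * (h t x * v t x ^ 2) := by gcongr

end IsWeakSolution

end ViscousSheet

theorem theorem2p1 (σ ν : ℝ) (hσ : 0 < σ) (hν : 0 < ν) (h₀ h₀' v₀ : ℝ → ℝ)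
    (h₀_H1 : ViscousSheet.IsH1 h₀ h₀')
    (v₀_L2 : MemLp v₀ 2 ViscousSheet.unitMeasure)
    (h₀_nonneg : ∀ x ∈ Icc (0 : ℝ) 1, 0 ≤ h₀ x)
    (M : ℝ) (hM : M = ∫ x in (0 : ℝ)..1, h₀ x) (hM_pos : 0 < M) :
    ∃ A B A₁ B₁ : ℝ, 0 < A ∧ 0 < B ∧ 0 < A₁ ∧ 0 < B₁ ∧
      ∀ h hx hxx v vx : ℝ → ℝ → ℝ,
        ViscousSheet.IsWeakSolution σ ν h₀ v₀ h hx hxx v vx →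
        (∀ t, 0 ≤ t → ∫ x in (0 : ℝ)..1, h t x = M) ∧
        (∀ t, 0 ≤ t → ∫ x in (0 : ℝ)..1, hx t x ^ 2 ≤ A * Real.exp (-B * t)) ∧
        Tendsto (fun t => ViscousSheet.h1Norm (fun x => h t x - M) (hx t)) atTop (𝓝 0) ∧
        Tendsto (fun t => ViscousSheet.holderHalfNorm (fun x => h t x - M)) atTop (𝓝 0) ∧
        (∀ t, 0 ≤ t →
          ∫ x in (0 : ℝ)..1, (h t x ^ (3 / 2 : ℝ) * v t x) ^ 2 ≤ A₁ * Real.exp (-B₁ * t)) ∧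
        Tendsto (fun t => eLpNorm (v t) 2 ViscousSheet.unitMeasure) atTop (𝓝 0) := by
  open ViscousSheet in
  rw [integral_unit] at hM
  have hN1 : 0 ≤ ∫ x, h₀ x * v₀ x ^ 2 ∂unitMeasure := integral_nonneg_of_ae <| by
    filter_upwards [ae_unit_mem_Icc] with x hx using mul_nonneg (h₀_nonneg x hx) (sq_nonneg _)
  have hN2 : 0 ≤ ∫ x, h₀' x ^ 2 ∂unitMeasure := integral_nonneg fun x => sq_nonneg _
  obtain ⟨A, β, hA, hβ, H⟩ := IsWeakSolution.exists_energy_decay hσ hν hM_pos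
    -- N depends on the data alone; the summand 1 keeps it positive when the initial energy is zero.
    (N := (∫ x, h₀ x * v₀ x ^ 2 ∂unitMeasure) + σ * (∫ x, h₀' x ^ 2 ∂unitMeasure) + 1)
    (by positivity)
  -- M + √A bounds h at all times, because ∫ h_x² ≤ A.
  refine ⟨A, β, (M + √A) ^ 2 * A, β, hA, hβ, by positivity, hβ, ?_⟩
  intro h hx hxx v vx S
  have hdecay := H h₀ v₀ h hx hxx v vx S hM.symm
    (by rw [S.kinetic_zero, S.slopeEnergy_zero h₀_H1]; linarith)
  have hmass : ∀ t, 0 ≤ t → ∫ x, h t x ∂unitMeasure = M := fun t ht =>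
    (S.integral_height ht).trans hM.symm
  have hslope : ∀ t, 0 ≤ t → ∫ x, hx t x ^ 2 ∂unitMeasure ≤ A * Real.exp (-β * t) :=
    fun t ht => (hdecay t ht).2
  have hexp : Tendsto (fun t => A * Real.exp (-β * t)) atTop (𝓝 0) := by
    have h1 : Tendsto (fun t : ℝ => -β * t) atTop atBot :=
      tendsto_id.const_mul_atTop_of_neg (by linarith)
    simpa using (Real.tendsto_exp_atBot.comp h1).const_mul A
  have hsqrt : Tendsto (fun t => ENNReal.ofReal (√(A * Real.exp (-β * t)))) atTop (𝓝 0) := by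
    have h1 := ENNReal.tendsto_ofReal ((Real.continuous_sqrt.tendsto 0).comp hexp)
    simpa using h1
  simp only [integral_unit]
  refine ⟨hmass, hslope, ?_, ?_, ?_, ?_⟩
  · refine tendsto_of_tendsto_of_tendsto_of_le_of_le' tendsto_const_nhds ?_
      (Eventually.of_forall fun t => zero_le) ((eventually_ge_atTop 0).mono fun t ht =>
        (S.h_H1 t ht).h1Norm_le (hmass t ht) (hslope t ht))
    have h1 : Tendsto (fun t => 2 * ENNReal.ofReal (√(A * Real.exp (-β * t))) ^ 2) atTop (𝓝 0) := by
      have h2 := ENNReal.Tendsto.const_mul (a := 2)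
        (ENNReal.Tendsto.pow hsqrt (n := 2)) (Or.inr (by simp))
      simpa using h2
    have h3 := ((ENNReal.continuous_rpow_const (y := 1 / 2)).tendsto 0).comp h1
    simpa [Function.comp_def] using h3
  · refine tendsto_of_tendsto_of_tendsto_of_le_of_le' tendsto_const_nhds ?_
      (Eventually.of_forall fun t => zero_le) ((eventually_ge_atTop 0).mono fun t ht =>
        (S.h_H1 t ht).holderHalfNorm_le (hmass t ht) (hslope t ht))
    simpa using hsqrt.add hsqrt
  · intro t ht
    have hle : A * Real.exp (-β * t) ≤ A :=
      mul_le_of_le_one_right hA.le (Real.exp_le_one_iff.2 (by nlinarith))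
    have hK : ∀ x ∈ Icc (0 : ℝ) 1, h t x ≤ M + √A := fun x hxm =>
      (S.h_H1 t ht).le_mean_add (hmass t ht) ((hslope t ht).trans hle) hxm
    calc ∫ x, (h t x ^ (3 / 2 : ℝ) * v t x) ^ 2 ∂unitMeasure
        ≤ (M + √A) ^ 2 * kinetic h v t := S.integral_weighted_velocity_le ht hK
      _ ≤ (M + √A) ^ 2 * (A * Real.exp (-β * t)) := by
          gcongr
          exact (hdecay t ht).1
      _ = _ := by ring
  · have hlim : Tendsto (fun t => ENNReal.ofReal (√(2 / M * (A * Real.exp (-β * t))))) atTop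
        (𝓝 0) := by
      have h1 := hexp.const_mul (2 / M)
      rw [mul_zero] at h1
      have h2 := ENNReal.tendsto_ofReal ((Real.continuous_sqrt.tendsto 0).comp h1)
      simpa using h2
    -- From then on h ≥ M/2, so ∫ v² ≤ (2/M) ∫ h v². Earlier h may vanish and the kinetic energy
    -- does not control v.
    have hsmall : ∀ᶠ t in atTop, A * Real.exp (-β * t) ≤ M ^ 2 / 4 :=
      hexp.eventually_le_const (by positivity)
    refine tendsto_of_tendsto_of_tendsto_of_le_of_le' tendsto_const_nhds hlim
      (Eventually.of_forall fun t => zero_le) ?_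
    filter_upwards [hsmall, eventually_ge_atTop 0] with t h1 ht
    refine eLpNorm_two_le (S.v_mem t ht) ?_
    have h2 : ∀ x ∈ Icc (0 : ℝ) 1, M / 2 ≤ h t x := fun x hxm =>
      (S.h_H1 t ht).half_mean_le (hmass t ht) hM_pos ((hslope t ht).trans h1) hxm
    have h3 := (le_weighted_integral (S.height_continuousOn ht) (S.v_mem t ht) h2).trans
      (hdecay t ht).1
    rw [div_mul_eq_mul_div, le_div_iff₀ hM_pos]
    linarith
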